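/- A \emph{convex polygon} is a compact convex polygonal region of $\mathbb{R}^2$ with nonempty interior; its vertices are its genuine corners (all interior angles are strictly less than $\pi$). A \emph{tiling} of the plane by convex polygons is a family of convex polygons that covers $\mathbb{R}^2$ and whose members have pairwise disjoint interiors. It is \emph{edge-to-edge} if no vertex of a tile is a relative interior point of an edge of another tile. For every integer $k \ge 2$ there is an edge-to-edge tiling of the Euclidean plane by convex polygons such that every tile has area $1$, every tile has at least six edges, the perimeters of the tiles are bounded from above and from below by positive numbers, and exactly $k$ of the tiles are not hexagons. -/

import Mathlib

/-- The Euclidean plane. -/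
abbrev Plane : Type := EuclideanSpace ℝ (Fin 2)

/-- Twice the signed area of the triangle `a b c`. It is positive exactly when `c` lies strictly
to the left of the oriented line from `a` to `b`. -/
def signedArea (a b c : Plane) : ℝ :=
  (b 0 - a 0) * (c 1 - a 1) - (b 1 - a 1) * (c 0 - a 0)

/-- A (nondegenerate) convex polygon in the plane, given by its vertices listed in
counterclockwise order. The condition `strictConvex` says that every vertex other than the two
endpoints of an edge lies strictly to the left of that edge. So the listed points are precisely
the vertices of their convex hull (no angle equals `π`), and the polygon has exactly
`numEdges` vertices and `numEdges` edges. -/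
structure ConvexPolygon where
  /-- The number of edges (equivalently, of vertices). -/
  numEdges : ℕ
  three_le : 3 ≤ numEdges
  /-- The vertices in counterclockwise cyclic order. -/
  toPolygon : Polygon Plane numEdges
  strictConvex : haveI : NeZero numEdges := ⟨by omega⟩
    ∀ i j : Fin numEdges, j ≠ i → j ≠ i + 1 →
      0 < signedArea (toPolygon i) (toPolygon (i + 1)) (toPolygon j)

namespace ConvexPolygon

instance (P : ConvexPolygon) : NeZero P.numEdges := ⟨by have := P.three_le; omega⟩

/-- The closed region of the plane occupied by the polygon. -/
def region (P : ConvexPolygon) : Set Plane :=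
  convexHull ℝ (Set.range P.toPolygon)

/-- The set of vertices. -/
def vertexSet (P : ConvexPolygon) : Set Plane :=
  Set.range P.toPolygon

/-- The relative interior of the `i`-th edge, i.e. the edge without its two endpoints. -/
def openEdge (P : ConvexPolygon) (i : Fin P.numEdges) : Set Plane :=
  openSegment ℝ (P.toPolygon i) (P.toPolygon (i + 1))

/-- The perimeter: the sum of the lengths of the edges. -/
noncomputable def perimeter (P : ConvexPolygon) : ℝ :=
  ∑ i : Fin P.numEdges, dist (P.toPolygon i) (P.toPolygon (i + 1))

end ConvexPolygon

/-- A family of convex polygons is a tiling of the plane if the polygons cover the plane and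
distinct ones have disjoint interiors. -/
def IsTiling (F : Set ConvexPolygon) : Prop :=
  (⋃ P ∈ F, P.region) = Set.univ ∧
    ∀ P ∈ F, ∀ Q ∈ F, P ≠ Q → Disjoint (interior P.region) (interior Q.region)

/-- An irregular vertex is a vertex of a tile that is a relative interior point of an edge of
another tile. -/
def IsIrregularVertex (F : Set ConvexPolygon) (p : Plane) : Prop :=
  ∃ P ∈ F, ∃ Q ∈ F, Q ≠ P ∧ p ∈ P.vertexSet ∧ ∃ i : Fin Q.numEdges, p ∈ Q.openEdge i

/-- A tiling is edge-to-edge if it has no irregular vertices. -/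
def IsEdgeToEdge (F : Set ConvexPolygon) : Prop :=
  ∀ p : Plane, ¬ IsIrregularVertex F p

/-- Every tile has area one. -/
def IsUnitArea (F : Set ConvexPolygon) : Prop :=
  ∀ P ∈ F, MeasureTheory.volume P.region = 1

/-- The perimeters of the tiles are bounded from above and from below by positive numbers. -/
def HasBoundedPerimeter (F : Set ConvexPolygon) : Prop :=
  ∃ c C : ℝ, 0 < c ∧ ∀ P ∈ F, c ≤ P.perimeter ∧ P.perimeter ≤ C

/-! The plane is cut into rows by zigzag curves. Curve `n` runs between upper vertices at height `n`
and lower vertices at height `n - q`. From upper vertex `i` of curve `n` a wall rises to lower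
vertex `i` of curve `n + 1`, so every vertex has degree three, and tile `(n, i)` lies between walls
`i` and `i + 1`. With a V-shaped floor and a single peak as ceiling it is a hexagon. Two consecutive
upper vertices may instead be joined by a horizontal edge: the tile below gains a vertex and the
tile above loses one. A heptagon therefore starts a column: every tile above it has flat floor and
flat ceiling, hence is again a hexagon, forever upwards. Columns starting in rows `0, ..., k - 1`
give exactly `k` heptagons.

Let a tile have width `w` at floor height, `w'` at the upper ends of its walls and `t` along the
ceiling. The triples `(1, 1, 0)` (ordinary), `(1/2, 3/2, 1/2)` (column) and `(1, 1 - q/2, 1/2)`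
(heptagon) all give area exactly 1. Upper vertices are spaced by 1, or by 1/2 along a flat edge.
Lower vertices follow them at an offset `gap` that is constant on a curve, except for one jump where
a heptagon needs its own width. Walls lean to the right, by at most `k + 4/5` because there are only
`k` columns. This bounds the perimeters, and a `q` small compared with `1/k` keeps all tiles convex.

The pillars are `exists_isTileAt` (shape and area), `exists_mem_region` (covering),
`eq_of_mem_regions` (disjointness), `IsTileAt.vertex_notMem_openEdge` (edge-to-edge) and
`IsTileAt.index_eq` (the count). -/

/-! ### Coordinates and half-planes. -/

/-- The point of the plane with coordinates `x` and `y`. -/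
def pt (x y : ℝ) : Plane := !₂[x, y]

@[simp] lemma pt_zero (x y : ℝ) : pt x y 0 = x := rfl

@[simp] lemma pt_one (x y : ℝ) : pt x y 1 = y := rfl

lemma plane_ext {z w : Plane} (h0 : z 0 = w 0) (h1 : z 1 = w 1) : z = w := by
  ext i
  fin_cases i
  · exact h0
  · exact h1

lemma pt_eta (z : Plane) : pt (z 0) (z 1) = z := plane_ext rfl rfl

lemma signedArea_pt (a b c d e f : ℝ) :
    signedArea (pt a b) (pt c d) (pt e f) = (c - a) * (f - b) - (d - b) * (e - a) := rfl

lemma signedArea_left (a b : Plane) : signedArea a b a = 0 := by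
  simp [signedArea]

lemma signedArea_right (a b : Plane) : signedArea a b b = 0 := by
  simp only [signedArea]; ring

lemma convex_signedArea_nonneg (a b : Plane) : Convex ℝ {z | 0 ≤ signedArea a b z} := by
  intro x hx y hy s t hs ht hst
  simp only [Set.mem_ofPred_eq] at *
  have : signedArea a b (s • x + t • y) = s * signedArea a b x + t * signedArea a b y := by
    obtain rfl : s = 1 - t := by linarith
    simp only [signedArea, PiLp.add_apply, PiLp.smul_apply, smul_eq_mul]
    ring
  rw [this]
  positivity

/-- Vertices in strictly convex position, in counterclockwise order. -/
def StrictlyConvex {n : ℕ} [NeZero n] (v : Fin n → Plane) : Prop :=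
  ∀ i j : Fin n, j ≠ i → j ≠ i + 1 → 0 < signedArea (v i) (v (i + 1)) (v j)

lemma StrictlyConvex.signedArea_nonneg {n : ℕ} [NeZero n] {v : Fin n → Plane}
    (h : StrictlyConvex v) (i : Fin n) {z : Plane} (hz : z ∈ convexHull ℝ (Set.range v)) :
    0 ≤ signedArea (v i) (v (i + 1)) z := by
  refine convexHull_min ?_ (convex_signedArea_nonneg _ _) hz
  rintro _ ⟨j, rfl⟩
  by_cases h1 : j = i
  · subst h1; exact (signedArea_left _ _).ge
  by_cases h2 : j = i + 1
  · subst h2; exact (signedArea_right _ _).ge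
  · exact (h i j h1 h2).le

lemma mem_Icc_of_mem_convexHull {V : Set Plane} {m M : ℝ} (h : ∀ v ∈ V, v 1 ∈ Set.Icc m M)
    {z : Plane} (hz : z ∈ convexHull ℝ V) : z 1 ∈ Set.Icc m M := by
  refine convexHull_min (t := {z : Plane | z 1 ∈ Set.Icc m M}) h ?_ hz
  exact (convex_Icc m M).linear_preimage (EuclideanSpace.proj (𝕜 := ℝ) (1 : Fin 2)).toLinearMap

/-! ### Trapezoids and their areas. -/

/-- The trapezoid with horizontal sides `[a₀, b₀] × {y₀}` and `[a₁, b₁] × {y₁}`. -/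
def trapezoid (y₀ y₁ a₀ b₀ a₁ b₁ : ℝ) : Set Plane :=
  {z | y₀ ≤ z 1 ∧ z 1 ≤ y₁ ∧ 0 ≤ signedArea (pt a₁ y₁) (pt a₀ y₀) z ∧
    0 ≤ signedArea (pt b₀ y₀) (pt b₁ y₁) z}

/-- The abscissa at height `y` of the line through `(x₀, y₀)` and `(x₁, y₁)`. -/
noncomputable def lineAt (y₀ y₁ x₀ x₁ y : ℝ) : ℝ :=
  x₀ + (x₁ - x₀) * ((y - y₀) / (y₁ - y₀))

lemma lineAt_le_iff {y₀ y₁ : ℝ} (h : y₀ < y₁) (x₀ x₁ : ℝ) (z : Plane) :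
    0 ≤ signedArea (pt x₁ y₁) (pt x₀ y₀) z ↔ lineAt y₀ y₁ x₀ x₁ (z 1) ≤ z 0 := by
  have h' : 0 < y₁ - y₀ := sub_pos.2 h
  have : signedArea (pt x₁ y₁) (pt x₀ y₀) z
      = (y₁ - y₀) * (z 0 - lineAt y₀ y₁ x₀ x₁ (z 1)) := by
    simp only [signedArea, lineAt, pt_zero, pt_one]
    field_simp
    ring
  rw [this, mul_nonneg_iff_of_pos_left h', sub_nonneg]

lemma le_lineAt_iff {y₀ y₁ : ℝ} (h : y₀ < y₁) (x₀ x₁ : ℝ) (z : Plane) :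
    0 ≤ signedArea (pt x₀ y₀) (pt x₁ y₁) z ↔ z 0 ≤ lineAt y₀ y₁ x₀ x₁ (z 1) := by
  have h' : 0 < y₁ - y₀ := sub_pos.2 h
  have : signedArea (pt x₀ y₀) (pt x₁ y₁) z
      = (y₁ - y₀) * (lineAt y₀ y₁ x₀ x₁ (z 1) - z 0) := by
    simp only [signedArea, lineAt, pt_zero, pt_one]
    field_simp
    ring
  rw [this, mul_nonneg_iff_of_pos_left h', sub_nonneg]

lemma mem_trapezoid_iff {y₀ y₁ : ℝ} (h : y₀ < y₁) (a₀ b₀ a₁ b₁ : ℝ) (z : Plane) :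
    z ∈ trapezoid y₀ y₁ a₀ b₀ a₁ b₁ ↔ z 1 ∈ Set.Icc y₀ y₁ ∧
      z 0 ∈ Set.Icc (lineAt y₀ y₁ a₀ a₁ (z 1)) (lineAt y₀ y₁ b₀ b₁ (z 1)) := by
  rw [trapezoid, Set.mem_ofPred_eq, lineAt_le_iff h, le_lineAt_iff h, Set.mem_Icc, Set.mem_Icc,
    and_assoc]

lemma pt_lineAt_mem {S : Set Plane} (hS : Convex ℝ S) {y₀ y₁ x₀ x₁ y : ℝ} (h : y₀ < y₁)
    (h0 : pt x₀ y₀ ∈ S) (h1 : pt x₁ y₁ ∈ S) (hy : y ∈ Set.Icc y₀ y₁) :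
    pt (lineAt y₀ y₁ x₀ x₁ y) y ∈ S := by
  have h' : 0 < y₁ - y₀ := sub_pos.2 h
  set t := (y - y₀) / (y₁ - y₀) with ht
  have ht0 : 0 ≤ t := div_nonneg (sub_nonneg.2 hy.1) h'.le
  have ht1 : t ≤ 1 := by rw [ht, div_le_one h']; linarith [hy.2]
  have ht2 : t * (y₁ - y₀) = y - y₀ := div_mul_cancel₀ _ h'.ne'
  convert hS h0 h1 (sub_nonneg.2 ht1) ht0 (by ring) using 1
  apply plane_ext
  · simp only [lineAt, pt_zero, PiLp.add_apply, PiLp.smul_apply, smul_eq_mul, ← ht]; ring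
  · simp only [pt_one, PiLp.add_apply, PiLp.smul_apply, smul_eq_mul]; linarith

lemma pt_mem_of_mem_Icc {S : Set Plane} (hS : Convex ℝ S) {L R x y : ℝ}
    (h0 : pt L y ∈ S) (h1 : pt R y ∈ S) (hx : x ∈ Set.Icc L R) : pt x y ∈ S := by
  rcases hx.1.eq_or_lt with rfl | hL
  · exact h0
  have h' : 0 < R - L := by linarith [hx.2]
  set t := (x - L) / (R - L) with ht
  have ht0 : 0 ≤ t := div_nonneg (sub_nonneg.2 hx.1) h'.le
  have ht1 : t ≤ 1 := by rw [ht, div_le_one h']; linarith [hx.2]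
  have ht2 : t * (R - L) = x - L := div_mul_cancel₀ _ h'.ne'
  convert hS h0 h1 (sub_nonneg.2 ht1) ht0 (by ring) using 1
  apply plane_ext
  · simp only [pt_zero, PiLp.add_apply, PiLp.smul_apply, smul_eq_mul]; linarith
  · simp only [pt_one, PiLp.add_apply, PiLp.smul_apply, smul_eq_mul]; ring

lemma trapezoid_subset {S : Set Plane} (hS : Convex ℝ S) {y₀ y₁ a₀ b₀ a₁ b₁ : ℝ} (h : y₀ < y₁)
    (ha₀ : pt a₀ y₀ ∈ S) (hb₀ : pt b₀ y₀ ∈ S) (ha₁ : pt a₁ y₁ ∈ S) (hb₁ : pt b₁ y₁ ∈ S) :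
    trapezoid y₀ y₁ a₀ b₀ a₁ b₁ ⊆ S := by
  intro z hz
  obtain ⟨hy, hx⟩ := (mem_trapezoid_iff h _ _ _ _ z).1 hz
  rw [← pt_eta z]
  exact pt_mem_of_mem_Icc hS (pt_lineAt_mem hS h ha₀ ha₁ hy) (pt_lineAt_mem hS h hb₀ hb₁ hy) hx

lemma isClosed_trapezoid {y₀ y₁ : ℝ} (a₀ b₀ a₁ b₁ : ℝ) :
    IsClosed (trapezoid y₀ y₁ a₀ b₀ a₁ b₁) := by
  unfold trapezoid signedArea
  simp only [Set.ofPred_and]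
  refine IsClosed.inter ?_ (IsClosed.inter ?_ (IsClosed.inter ?_ ?_)) <;>
    exact isClosed_le (by fun_prop) (by fun_prop)

/-- The coordinates of a point of the plane, as a pair. -/
noncomputable def coordEquiv : Plane ≃ᵐ ℝ × ℝ :=
  (MeasurableEquiv.toLp 2 (Fin 2 → ℝ)).symm.trans (MeasurableEquiv.finTwoArrow)

lemma measurePreserving_coordEquiv_symm :
    MeasureTheory.MeasurePreserving coordEquiv.symm := by
  apply MeasureTheory.MeasurePreserving.symm
  exact (MeasureTheory.volume_preserving_finTwoArrow ℝ).comp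
    (EuclideanSpace.volume_preserving_symm_measurableEquiv_toLp (Fin 2))

lemma coordEquiv_symm_apply (x y : ℝ) : coordEquiv.symm (x, y) = pt x y := by
  rw [MeasurableEquiv.symm_apply_eq]; rfl

open MeasureTheory in
-- Fubini along horizontal slices: the slice at height `y` is an interval whose length is affine in
-- `y`.
lemma volume_trapezoid {y₀ y₁ a₀ b₀ a₁ b₁ : ℝ} (h : y₀ < y₁) (h₀ : a₀ ≤ b₀) (h₁ : a₁ ≤ b₁) :
    volume (trapezoid y₀ y₁ a₀ b₀ a₁ b₁)
      = ENNReal.ofReal ((y₁ - y₀) * ((b₀ - a₀) + (b₁ - a₁)) / 2) := by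
  have h' : 0 < y₁ - y₀ := sub_pos.2 h
  rw [← measurePreserving_coordEquiv_symm.measure_preimage_equiv, Measure.volume_eq_prod,
    Measure.prod_apply_symm
      (coordEquiv.symm.measurable (isClosed_trapezoid _ _ _ _).measurableSet)]
  set g : ℝ → ℝ := fun y => (b₀ - a₀) + ((b₁ - a₁) - (b₀ - a₀)) * ((y - y₀) / (y₁ - y₀)) with hg
  have hgc : Continuous g := by rw [hg]; fun_prop
  have key : ∀ y : ℝ, volume ((fun x => (x, y)) ⁻¹' (coordEquiv.symm ⁻¹'
      trapezoid y₀ y₁ a₀ b₀ a₁ b₁)) =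
      (Set.Icc y₀ y₁).indicator (fun y => ENNReal.ofReal (g y)) y := by
    intro y
    by_cases hy : y ∈ Set.Icc y₀ y₁
    · rw [Set.indicator_of_mem hy]
      have : (fun x => (x, y)) ⁻¹' (coordEquiv.symm ⁻¹' trapezoid y₀ y₁ a₀ b₀ a₁ b₁)
          = Set.Icc (lineAt y₀ y₁ a₀ a₁ y) (lineAt y₀ y₁ b₀ b₁ y) := by
        ext x
        rw [Set.mem_preimage, Set.mem_preimage, coordEquiv_symm_apply, mem_trapezoid_iff h]
        simp only [pt_one, pt_zero, hy, true_and]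
      rw [this, Real.volume_Icc]
      congr 1
      simp only [lineAt, hg]
      ring
    · rw [Set.indicator_of_notMem hy]
      convert measure_empty (μ := volume)
      ext x
      rw [Set.mem_preimage, Set.mem_preimage, coordEquiv_symm_apply, mem_trapezoid_iff h]
      simp only [pt_one, hy, false_and, Set.mem_empty_iff_false]
  simp_rw [key]
  rw [lintegral_indicator measurableSet_Icc, ← ofReal_integral_eq_lintegral_ofReal]
  · congr 1
    rw [integral_Icc_eq_integral_Ioc, ← intervalIntegral.integral_of_le h.le]
    rw [intervalIntegral.integral_eq_sub_of_hasDerivAt (f := fun y => (b₀ - a₀) * y +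
      ((b₁ - a₁) - (b₀ - a₀)) * ((y - y₀) ^ 2 / (2 * (y₁ - y₀))))]
    · field_simp
      ring
    · intro x _
      have h1 : HasDerivAt (fun y => (y - y₀) ^ 2) (2 * (x - y₀)) x := by
        simpa using ((hasDerivAt_id' x).sub_const y₀).fun_pow 2
      have h2 : HasDerivAt (fun y => (b₀ - a₀) * y) (b₀ - a₀) x := by
        simpa using (hasDerivAt_id x).const_mul (b₀ - a₀)
      convert h2.fun_add ((h1.div_const (2 * (y₁ - y₀))).const_mul ((b₁ - a₁) - (b₀ - a₀))) using 1
      rw [hg, mul_div_mul_left _ _ two_ne_zero]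
    · exact hgc.intervalIntegrable _ _
  · exact (hgc.continuousOn.integrableOn_compact isCompact_Icc)
  · refine (ae_restrict_iff' measurableSet_Icc).2 (Filter.Eventually.of_forall fun y hy => ?_)
    have ht0 : 0 ≤ (y - y₀) / (y₁ - y₀) := div_nonneg (sub_nonneg.2 hy.1) h'.le
    have ht1 : (y - y₀) / (y₁ - y₀) ≤ 1 := by rw [div_le_one h']; linarith [hy.2]
    simp only [hg, Pi.zero_apply]
    nlinarith [mul_nonneg (sub_nonneg.2 h₁) ht0, mul_nonneg (sub_nonneg.2 h₀) (sub_nonneg.2 ht1)]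

open MeasureTheory in
lemma volume_setOf_apply_one_eq (y : ℝ) : volume {z : Plane | z 1 = y} = 0 := by
  rw [← measurePreserving_coordEquiv_symm.measure_preimage_equiv, Measure.volume_eq_prod]
  have : coordEquiv.symm ⁻¹' {z : Plane | z 1 = y} = Set.univ ×ˢ {y} := by
    ext ⟨a, b⟩
    simp [coordEquiv_symm_apply]
  rw [this, Measure.prod_prod]
  simp

/-! ### The three shapes of tiles and their convexity. -/

/-- The tile with bottom corners `(a, y)`, `(b, y)`, upper corners `(l, y + 1 - q)`,
`(r, y + 1 - q)`, top corners `(s₁, y + 1)`, `(s₂, y + 1)` and, for each `p ∈ D`, a bottom corner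
`(p, y - q)`. -/
structure IsTile (q y a b l r s₁ s₂ : ℝ) (D : Set ℝ) (P : ConvexPolygon) : Prop where
  region_eq : P.region = trapezoid y (y + 1 - q) a b l r ∪
    trapezoid (y + 1 - q) (y + 1) l r s₁ s₂ ∪ ⋃ p ∈ D, trapezoid (y - q) y p p a b
  vertex : ∀ v ∈ P.vertexSet, v = pt a y ∨ v = pt b y ∨ v = pt l (y + 1 - q) ∨
    v = pt r (y + 1 - q) ∨ v = pt s₁ (y + 1) ∨ v = pt s₂ (y + 1) ∨ ∃ p ∈ D, v = pt p (y - q)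
  edge : ∀ i, ∀ z ∈ P.openEdge i, z 1 ∈ Set.Ioo y (y + 1 - q) ∨
    z 1 ∈ Set.Ioo (y + 1 - q) (y + 1) ∨ z 1 ∈ Set.Ioo (y - q) y ∨
    (z 1 = y ∧ z 0 ∈ Set.Ioo a b) ∨ (z 1 = y + 1 ∧ z 0 ∈ Set.Ioo s₁ s₂)
  perimeter_ge : 1 / 2 ≤ P.perimeter
  perimeter_le : P.perimeter ≤ 7 * (r - a + 2)

lemma openSegment_apply_one_mem {x₀ y₀ x₁ y₁ : ℝ} {z : Plane}
    (hz : z ∈ openSegment ℝ (pt x₀ y₀) (pt x₁ y₁)) :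
    (y₀ < y₁ → z 1 ∈ Set.Ioo y₀ y₁) ∧ (y₁ < y₀ → z 1 ∈ Set.Ioo y₁ y₀) := by
  obtain ⟨s, t, hs, ht, hst, rfl⟩ := hz
  obtain rfl : s = 1 - t := by linarith
  simp only [PiLp.add_apply, PiLp.smul_apply, smul_eq_mul, pt_one, Set.mem_Ioo]
  exact ⟨fun h => ⟨by nlinarith, by nlinarith⟩, fun h => ⟨by nlinarith, by nlinarith⟩⟩

lemma openSegment_horizontal {x₀ x₁ y : ℝ} {z : Plane}
    (hz : z ∈ openSegment ℝ (pt x₀ y) (pt x₁ y)) :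
    z 1 = y ∧ (x₀ < x₁ → z 0 ∈ Set.Ioo x₀ x₁) ∧ (x₁ < x₀ → z 0 ∈ Set.Ioo x₁ x₀) := by
  obtain ⟨s, t, hs, ht, hst, rfl⟩ := hz
  obtain rfl : s = 1 - t := by linarith
  simp only [PiLp.add_apply, PiLp.smul_apply, smul_eq_mul, pt_zero, pt_one, Set.mem_Ioo]
  exact ⟨by ring, fun h => ⟨by nlinarith, by nlinarith⟩, fun h => ⟨by nlinarith, by nlinarith⟩⟩

lemma dist_le_abs_add_abs (v w : Plane) : dist v w ≤ |v 0 - w 0| + |v 1 - w 1| := by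
  rw [EuclideanSpace.dist_eq, Fin.sum_univ_two, Real.dist_eq, Real.dist_eq]
  refine Real.sqrt_le_iff.2 ⟨by positivity, ?_⟩
  nlinarith [mul_nonneg (abs_nonneg (v 0 - w 0)) (abs_nonneg (v 1 - w 1))]

lemma abs_le_dist (v w : Plane) : |v 1 - w 1| ≤ dist v w := by
  rw [EuclideanSpace.dist_eq, Fin.sum_univ_two, Real.dist_eq, Real.dist_eq]
  refine Real.le_sqrt_of_sq_le ?_
  nlinarith [sq_nonneg |v 0 - w 0|]

lemma ConvexPolygon.perimeter_le (P : ConvexPolygon) {C : ℝ} {m : ℕ} (hm : P.numEdges ≤ m)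
    (hC : 0 ≤ C) (h : ∀ v ∈ P.vertexSet, ∀ w ∈ P.vertexSet, dist v w ≤ C) :
    P.perimeter ≤ m * C := by
  refine (Finset.sum_le_card_nsmul _ _ C fun i _ =>
    h _ (Set.mem_range_self _) _ (Set.mem_range_self _)).trans ?_
  rw [Finset.card_univ, Fintype.card_fin, nsmul_eq_mul]
  gcongr

lemma ConvexPolygon.le_perimeter (P : ConvexPolygon) (i : Fin P.numEdges) :
    dist (P.toPolygon i) (P.toPolygon (i + 1)) ≤ P.perimeter :=
  Finset.single_le_sum (f := fun i => dist (P.toPolygon i) (P.toPolygon (i + 1)))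
    (fun _ _ => dist_nonneg) (Finset.mem_univ i)

/-- The metric inequalities under which the tiles are convex. -/
structure TileBounds (q a b l r s₁ s₂ : ℝ) : Prop where
  q_pos : 0 < q
  q_le : q ≤ 1 / 30
  slope : q * (r - a) ≤ 1 / 10
  hab : a + 1 / 5 ≤ b
  hal : a ≤ l
  hbr : b ≤ r
  hls : l + 1 / 5 ≤ s₁
  hss : s₁ ≤ s₂
  hsr : s₂ + 1 / 5 ≤ r

section Tiles

variable {q y a b l r s₁ s₂ p : ℝ}

/-- Common to all three shapes; `D` is empty for a flat floor and a singleton for a V. Convexity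
puts the trapezoids inside the region; conversely, the half-planes in `hR` confine a point to the
trapezoid belonging to its height. -/
lemma IsTile.of_vertices {D : Set ℝ} (h : TileBounds q a b l r s₁ s₂)
    (hD : ∀ p ∈ D, a ≤ p ∧ p ≤ b) {P : ConvexPolygon} (hP : P.numEdges ≤ 7)
    (hV : P.vertexSet = {pt a y, pt b y, pt l (y + 1 - q), pt r (y + 1 - q), pt s₁ (y + 1),
      pt s₂ (y + 1)} ∪ (fun p => pt p (y - q)) '' D)
    (hE : ∀ i, ∀ z ∈ P.openEdge i, z 1 ∈ Set.Ioo y (y + 1 - q) ∨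
      z 1 ∈ Set.Ioo (y + 1 - q) (y + 1) ∨ z 1 ∈ Set.Ioo (y - q) y ∨
      (z 1 = y ∧ z 0 ∈ Set.Ioo a b) ∨ (z 1 = y + 1 ∧ z 0 ∈ Set.Ioo s₁ s₂))
    (hw : ∃ i, P.toPolygon i = pt l (y + 1 - q) ∧ P.toPolygon (i + 1) = pt a y)
    (hR : ∀ z ∈ P.region,
      0 ≤ signedArea (pt l (y + 1 - q)) (pt a y) z ∧
      0 ≤ signedArea (pt b y) (pt r (y + 1 - q)) z ∧
      0 ≤ signedArea (pt s₁ (y + 1)) (pt l (y + 1 - q)) z ∧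
      0 ≤ signedArea (pt r (y + 1 - q)) (pt s₂ (y + 1)) z ∧
      (y ≤ z 1 ∨ ∃ p ∈ D, 0 ≤ signedArea (pt a y) (pt p (y - q)) z ∧
        0 ≤ signedArea (pt p (y - q)) (pt b y) z)) :
    IsTile q y a b l r s₁ s₂ D P := by
  obtain ⟨hq, hq', hsl, hab, hal, hbr, hls, hss, hsr⟩ := h
  have hV' : ∀ v ∈ P.vertexSet, v = pt a y ∨ v = pt b y ∨ v = pt l (y + 1 - q) ∨
      v = pt r (y + 1 - q) ∨ v = pt s₁ (y + 1) ∨ v = pt s₂ (y + 1) ∨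
      ∃ p ∈ D, v = pt p (y - q) := by
    intro v hv
    rw [hV] at hv
    simpa only [Set.mem_union, Set.mem_insert_iff, Set.mem_singleton_iff, Set.mem_image, or_assoc,
      eq_comm (b := v)] using hv
  have hbox : ∀ v ∈ P.vertexSet, v 0 ∈ Set.Icc a r ∧ v 1 ∈ Set.Icc (y - q) (y + 1) := by
    intro v hv
    rcases hV' v hv with rfl | rfl | rfl | rfl | rfl | rfl | ⟨p, hp, rfl⟩
    on_goal 7 => have := hD p hp
    all_goals
      simp only [pt_zero, pt_one, Set.mem_Icc]
      refine ⟨⟨?_, ?_⟩, ?_, ?_⟩ <;> linarith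
  refine ⟨?_, hV', hE, ?_, ?_⟩
  · apply Set.Subset.antisymm
    · intro z hz
      have ⟨hy', hy⟩ := mem_Icc_of_mem_convexHull (fun v hv => (hbox v hv).2) hz
      obtain ⟨h1, h2, h3, h4, h5⟩ := hR z hz
      by_cases hz1 : y ≤ z 1
      · by_cases hz2 : z 1 ≤ y + 1 - q
        · exact Or.inl (Or.inl ⟨hz1, hz2, h1, h2⟩)
        · exact Or.inl (Or.inr ⟨(not_le.1 hz2).le, hy, h3, h4⟩)
      · obtain h | ⟨p, hp, h7, h8⟩ := h5
        · exact absurd h hz1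
        · exact Or.inr (Set.mem_biUnion hp ⟨hy', (not_le.1 hz1).le, h7, h8⟩)
    · have hS : Convex ℝ P.region := convex_convexHull ℝ _
      have hm : P.vertexSet ⊆ P.region := subset_convexHull ℝ _
      rw [hV] at hm
      have ha := hm (Or.inl (by simp) : pt a y ∈ _)
      have hb := hm (Or.inl (by simp) : pt b y ∈ _)
      have hl := hm (Or.inl (by simp) : pt l (y + 1 - q) ∈ _)
      have hr := hm (Or.inl (by simp) : pt r (y + 1 - q) ∈ _)
      have hs₁ := hm (Or.inl (by simp) : pt s₁ (y + 1) ∈ _)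
      have hs₂ := hm (Or.inl (by simp) : pt s₂ (y + 1) ∈ _)
      refine Set.union_subset (Set.union_subset ?_ ?_) (Set.iUnion₂_subset fun p hp => ?_)
      · exact trapezoid_subset hS (by linarith) ha hb hl hr
      · exact trapezoid_subset hS (by linarith) hl hr hs₁ hs₂
      · have hp := hm (Or.inr ⟨p, hp, rfl⟩)
        exact trapezoid_subset hS (by linarith) hp hp ha hb
  · obtain ⟨i, h1, h2⟩ := hw
    -- The left wall alone climbs `1 - q ≥ 1/2`.
    refine le_trans ?_ (P.le_perimeter i)
    rw [h1, h2]
    refine le_trans ?_ (abs_le_dist _ _)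
    rw [pt_one, pt_one]
    exact le_trans (by linarith) (le_abs_self _)
  · refine P.perimeter_le (C := r - a + 2) hP (by linarith) fun v hv w hw => ?_
    obtain ⟨⟨h1, h2⟩, h3, h4⟩ := hbox v hv
    obtain ⟨⟨h5, h6⟩, h7, h8⟩ := hbox w hw
    refine (dist_le_abs_add_abs v w).trans ?_
    have e1 : |v 0 - w 0| ≤ r - a := abs_le.2 ⟨by linarith, by linarith⟩
    have e2 : |v 1 - w 1| ≤ 2 := abs_le.2 ⟨by linarith, by linarith⟩
    linarith

/-- The delicate corners are the ends of the walls: the clearance `1/5` must beat a term of the form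
`q` times a horizontal extent, which the slope bound keeps below `1/10`. Every determinant is linear
in the abscissas and their products with `q`, so the products prepared below reduce everything to
linear arithmetic. -/
lemma strictlyConvex_hexagon (h : TileBounds q a b l r s₁ s₂) (hs : s₁ = s₂) (hap : a + 1 / 5 ≤ p)
    (hpb : p + 1 / 5 ≤ b) :
    StrictlyConvex ![pt a y, pt p (y - q), pt b y, pt r (y + 1 - q), pt s₂ (y + 1),
      pt l (y + 1 - q)] := by
  subst hs
  obtain ⟨hq, hq', hsl, hab, hal, hbr, hls, hss, hsr⟩ := h
  have h3 := mul_nonneg hq.le (by linarith : 0 ≤ l - a)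
  have h4 := mul_nonneg hq.le (by linarith : 0 ≤ r - b)
  have h5 := mul_pos hq (by linarith : 0 < s₁ - l)
  have h6 := mul_pos hq (by linarith : 0 < r - s₁)
  have h7 := mul_nonneg (sub_nonneg.2 hq') (by linarith : 0 ≤ s₁ - l)
  have h8 := mul_nonneg (sub_nonneg.2 hq') (by linarith : 0 ≤ r - s₁)
  have h1 := mul_pos hq (by linarith : 0 < p - a)
  have h2 := mul_pos hq (by linarith : 0 < b - p)
  have h1' := mul_nonneg (sub_nonneg.2 hq') (by linarith : 0 ≤ p - a)
  have h2' := mul_nonneg (sub_nonneg.2 hq') (by linarith : 0 ≤ b - p)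
  intro i j hj hj'
  fin_cases i <;> fin_cases j <;> first
    | exact absurd rfl hj
    | exact absurd rfl hj'
    | (simp only [Fin.reduceAdd, Fin.reduceFinMk, Fin.zero_eta, Fin.mk_one, Matrix.cons_val,
        signedArea_pt]
       linarith)

lemma strictlyConvex_hexagon_flat (h : TileBounds q a b l r s₁ s₂) (hs : s₁ < s₂) :
    StrictlyConvex ![pt a y, pt b y, pt r (y + 1 - q), pt s₂ (y + 1), pt s₁ (y + 1),
      pt l (y + 1 - q)] := by
  obtain ⟨hq, hq', hsl, hab, hal, hbr, hls, hss, hsr⟩ := h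
  have h3 := mul_nonneg hq.le (by linarith : 0 ≤ l - a)
  have h4 := mul_nonneg hq.le (by linarith : 0 ≤ r - b)
  have h5 := mul_pos hq (by linarith : 0 < s₁ - l)
  have h6 := mul_pos hq (by linarith : 0 < r - s₂)
  have h7 := mul_nonneg (sub_nonneg.2 hq') (by linarith : 0 ≤ s₁ - l)
  have h8 := mul_nonneg (sub_nonneg.2 hq') (by linarith : 0 ≤ r - s₂)
  have h9 := mul_pos hq (by linarith : 0 < s₂ - s₁)
  have h10 := mul_pos hq (by linarith : 0 < b - a)
  intro i j hj hj'
  fin_cases i <;> fin_cases j <;> first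
    | exact absurd rfl hj
    | exact absurd rfl hj'
    | (simp only [Fin.reduceAdd, Fin.reduceFinMk, Fin.zero_eta, Fin.mk_one, Matrix.cons_val,
        signedArea_pt]
       linarith)

lemma strictlyConvex_heptagon (h : TileBounds q a b l r s₁ s₂) (hs : s₁ < s₂)
    (hap : a + 1 / 5 ≤ p) (hpb : p + 1 / 5 ≤ b) :
    StrictlyConvex ![pt a y, pt p (y - q), pt b y, pt r (y + 1 - q), pt s₂ (y + 1),
      pt s₁ (y + 1), pt l (y + 1 - q)] := by
  obtain ⟨hq, hq', hsl, hab, hal, hbr, hls, hss, hsr⟩ := h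
  have h3 := mul_nonneg hq.le (by linarith : 0 ≤ l - a)
  have h4 := mul_nonneg hq.le (by linarith : 0 ≤ r - b)
  have h5 := mul_pos hq (by linarith : 0 < s₁ - l)
  have h6 := mul_pos hq (by linarith : 0 < r - s₂)
  have h7 := mul_nonneg (sub_nonneg.2 hq') (by linarith : 0 ≤ s₁ - l)
  have h8 := mul_nonneg (sub_nonneg.2 hq') (by linarith : 0 ≤ r - s₂)
  have h1 := mul_pos hq (by linarith : 0 < p - a)
  have h2 := mul_pos hq (by linarith : 0 < b - p)
  have h1' := mul_nonneg (sub_nonneg.2 hq') (by linarith : 0 ≤ p - a)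
  have h2' := mul_nonneg (sub_nonneg.2 hq') (by linarith : 0 ≤ b - p)
  have h9 := mul_pos hq (by linarith : 0 < s₂ - s₁)
  intro i j hj hj'
  fin_cases i <;> fin_cases j <;> first
    | exact absurd rfl hj
    | exact absurd rfl hj'
    | (simp only [Fin.reduceAdd, Fin.reduceFinMk, Fin.zero_eta, Fin.mk_one, Matrix.cons_val,
        signedArea_pt]
       linarith)

end Tiles

/-- The convex polygon with given vertices. -/
def ConvexPolygon.ofVertices {n : ℕ} [NeZero n] (hn : 3 ≤ n) (v : Fin n → Plane)
    (h : StrictlyConvex v) : ConvexPolygon :=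
  ⟨n, hn, ⟨v⟩, h⟩

lemma ConvexPolygon.openEdge_ofVertices {n : ℕ} [NeZero n] (hn : 3 ≤ n) (v : Fin n → Plane)
    (h : StrictlyConvex v) (i : Fin n) :
    (ofVertices hn v h).openEdge i = openSegment ℝ (v i) (v (i + 1)) := rfl

lemma ConvexPolygon.vertexSet_ofVertices {n : ℕ} [NeZero n] (hn : 3 ≤ n) (v : Fin n → Plane)
    (h : StrictlyConvex v) : (ofVertices hn v h).vertexSet = Set.range v := rfl

lemma ConvexPolygon.toPolygon_ofVertices {n : ℕ} [NeZero n] (hn : 3 ≤ n) (v : Fin n → Plane)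
    (h : StrictlyConvex v) (i : Fin n) : (ofVertices hn v h).toPolygon i = v i := rfl

lemma ConvexPolygon.toPolygon_ofVertices_succ {n : ℕ} [NeZero n] (hn : 3 ≤ n) (v : Fin n → Plane)
    (h : StrictlyConvex v) (i : Fin n) :
    (ofVertices hn v h).toPolygon ((show Fin (ofVertices hn v h).numEdges from i) + 1) = v (i + 1) :=
  rfl

section Tiles

variable {q y a b l r s₁ s₂ p : ℝ}

lemma exists_hexagon (h : TileBounds q a b l r s₁ s₂) (hs : s₁ = s₂)
    (hap : a + 1 / 5 ≤ p) (hpb : p + 1 / 5 ≤ b) :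
    ∃ P : ConvexPolygon, P.numEdges = 6 ∧ IsTile q y a b l r s₁ s₂ {p} P := by
  have hv := strictlyConvex_hexagon (y := y) h hs hap hpb
  have ⟨hq, hq', hsl, hab, hal, hbr, hls, hss, hsr⟩ := h
  refine ⟨.ofVertices (by norm_num) _ hv, rfl, .of_vertices h
    (by rintro _ rfl; constructor <;> linarith) (show 6 ≤ 7 by norm_num) ?_ ?_
    ⟨(5 : Fin _), ConvexPolygon.toPolygon_ofVertices _ _ hv 5,
      (ConvexPolygon.toPolygon_ofVertices_succ _ _ hv 5).trans rfl⟩ ?_⟩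
  · rw [ConvexPolygon.vertexSet_ofVertices]
    simp only [Matrix.range_cons, Matrix.range_empty]
    ext z
    simp [hs]
    tauto
  · intro i z hz
    change Fin 6 at i
    rw [ConvexPolygon.openEdge_ofVertices] at hz
    fin_cases i <;>
      simp only [Fin.reduceAdd, Fin.reduceFinMk, Fin.zero_eta, Fin.mk_one, Matrix.cons_val] at hz
    all_goals
      obtain ⟨e1, e2⟩ := openSegment_apply_one_mem hz
      first
        | exact Or.inl (e1 (by linarith))
        | exact Or.inl (e2 (by linarith))
        | exact Or.inr (Or.inl (e1 (by linarith)))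
        | exact Or.inr (Or.inl (e2 (by linarith)))
        | exact Or.inr (Or.inr (Or.inl (e1 (by linarith))))
        | exact Or.inr (Or.inr (Or.inl (e2 (by linarith))))
  · intro z hz
    exact ⟨hv.signedArea_nonneg 5 hz, hv.signedArea_nonneg 2 hz, hs ▸ hv.signedArea_nonneg 4 hz,
      hv.signedArea_nonneg 3 hz,
      Or.inr ⟨p, rfl, hv.signedArea_nonneg 0 hz, hv.signedArea_nonneg 1 hz⟩⟩

lemma exists_hexagon_flat (h : TileBounds q a b l r s₁ s₂) (hs : s₁ < s₂) :
    ∃ P : ConvexPolygon, P.numEdges = 6 ∧ IsTile q y a b l r s₁ s₂ ∅ P := by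
  have hv := strictlyConvex_hexagon_flat (y := y) h hs
  have ⟨hq, hq', hsl, hab, hal, hbr, hls, hss, hsr⟩ := h
  refine ⟨.ofVertices (by norm_num) _ hv, rfl, .of_vertices h
    (by simp) (show 6 ≤ 7 by norm_num) ?_ ?_
    ⟨(5 : Fin _), ConvexPolygon.toPolygon_ofVertices _ _ hv 5,
      (ConvexPolygon.toPolygon_ofVertices_succ _ _ hv 5).trans rfl⟩ ?_⟩
  · rw [ConvexPolygon.vertexSet_ofVertices]
    simp only [Matrix.range_cons, Matrix.range_empty]
    ext z
    simp
    tauto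
  · intro i z hz
    change Fin 6 at i
    rw [ConvexPolygon.openEdge_ofVertices] at hz
    fin_cases i <;>
      simp only [Fin.reduceAdd, Fin.reduceFinMk, Fin.zero_eta, Fin.mk_one, Matrix.cons_val] at hz
    all_goals
      obtain ⟨e1, e2⟩ := openSegment_apply_one_mem hz
      first
        | exact Or.inl (e1 (by linarith))
        | exact Or.inl (e2 (by linarith))
        | exact Or.inr (Or.inl (e1 (by linarith)))
        | exact Or.inr (Or.inl (e2 (by linarith)))
        | exact Or.inr (Or.inr (Or.inr (Or.inl ⟨(openSegment_horizontal hz).1,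
            (openSegment_horizontal hz).2.1 (by linarith)⟩)))
        | exact Or.inr (Or.inr (Or.inr (Or.inr ⟨(openSegment_horizontal hz).1,
            (openSegment_horizontal hz).2.2 (by linarith)⟩)))
  · intro z hz
    refine ⟨hv.signedArea_nonneg 5 hz, hv.signedArea_nonneg 1 hz, hv.signedArea_nonneg 4 hz,
      hv.signedArea_nonneg 2 hz, Or.inl ?_⟩
    have h0 : 0 ≤ signedArea (pt a y) (pt b y) z := hv.signedArea_nonneg 0 hz
    simp only [signedArea, pt_zero, pt_one, sub_self, zero_mul, sub_zero] at h0
    -- The floor edge is horizontal, so being to its left means being above it.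
    exact sub_nonneg.1 (nonneg_of_mul_nonneg_right h0 (by linarith))

lemma exists_heptagon (h : TileBounds q a b l r s₁ s₂) (hs : s₁ < s₂)
    (hap : a + 1 / 5 ≤ p) (hpb : p + 1 / 5 ≤ b) :
    ∃ P : ConvexPolygon, P.numEdges = 7 ∧ IsTile q y a b l r s₁ s₂ {p} P := by
  have hv := strictlyConvex_heptagon (y := y) h hs hap hpb
  have ⟨hq, hq', hsl, hab, hal, hbr, hls, hss, hsr⟩ := h
  refine ⟨.ofVertices (by norm_num) _ hv, rfl, .of_vertices h
    (by rintro _ rfl; constructor <;> linarith) (show 7 ≤ 7 from le_rfl) ?_ ?_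
    ⟨(6 : Fin _), ConvexPolygon.toPolygon_ofVertices _ _ hv 6,
      (ConvexPolygon.toPolygon_ofVertices_succ _ _ hv 6).trans rfl⟩ ?_⟩
  · rw [ConvexPolygon.vertexSet_ofVertices]
    simp only [Matrix.range_cons, Matrix.range_empty]
    ext z
    simp
    tauto
  · intro i z hz
    change Fin 7 at i
    rw [ConvexPolygon.openEdge_ofVertices] at hz
    fin_cases i <;>
      simp only [Fin.reduceAdd, Fin.reduceFinMk, Fin.zero_eta, Fin.mk_one, Matrix.cons_val] at hz
    all_goals
      obtain ⟨e1, e2⟩ := openSegment_apply_one_mem hz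
      first
        | exact Or.inl (e1 (by linarith))
        | exact Or.inl (e2 (by linarith))
        | exact Or.inr (Or.inl (e1 (by linarith)))
        | exact Or.inr (Or.inl (e2 (by linarith)))
        | exact Or.inr (Or.inr (Or.inl (e1 (by linarith))))
        | exact Or.inr (Or.inr (Or.inl (e2 (by linarith))))
        | exact Or.inr (Or.inr (Or.inr (Or.inr ⟨(openSegment_horizontal hz).1,
            (openSegment_horizontal hz).2.2 (by linarith)⟩)))
  · intro z hz
    exact ⟨hv.signedArea_nonneg 6 hz, hv.signedArea_nonneg 2 hz, hv.signedArea_nonneg 5 hz,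
      hv.signedArea_nonneg 3 hz,
      Or.inr ⟨p, rfl, hv.signedArea_nonneg 0 hz, hv.signedArea_nonneg 1 hz⟩⟩

end Tiles

/-! ### Combinatorics of the columns. -/

lemma Finset.filter_range_eq_range_card {k : ℕ} {p : ℕ → Prop} [DecidablePred p]
    (h : ∀ c d, c ≤ d → p d → p c) :
    (Finset.range k).filter p = Finset.range ((Finset.range k).filter p).card := by
  induction k with
  | zero => simp
  | succ k ih =>
    rw [Finset.range_add_one, Finset.filter_insert]
    by_cases hk : p k
    · have : (Finset.range k).filter p = Finset.range k :=
        Finset.filter_true_of_mem fun c hc => h c k (Finset.mem_range.1 hc).le hk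
      rw [if_pos hk, this, ← Finset.range_add_one, Finset.card_range]
    · rw [if_neg hk]; exact ih

/-- Increments bounded below make `f` unbounded in both directions. This locates a point between
consecutive walls or zigzag edges. -/
lemma exists_int_le_lt {f : ℤ → ℝ} {c : ℝ} (hc : 0 < c) (hf : ∀ i, f i + c ≤ f (i + 1)) (x : ℝ) :
    ∃ i, f i ≤ x ∧ x < f (i + 1) := by
  have hmono : StrictMono f := strictMono_int_of_lt_succ fun i => by linarith [hf i]
  have hup : ∀ m : ℕ, f 0 + m * c ≤ f m := by
    intro m
    induction m with
    | zero => simp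
    | succ m ih => push_cast; linarith [hf m]
  have hdown : ∀ m : ℕ, f (-m) ≤ f 0 - m * c := by
    intro m
    induction m with
    | zero => simp
    | succ m ih =>
      have := hf (-(m + 1))
      rw [show -((m : ℤ) + 1) + 1 = -m by ring] at this
      push_cast
      linarith
  obtain ⟨M, hM⟩ := exists_nat_gt ((x - f 0) / c)
  obtain ⟨N, hN⟩ := exists_nat_gt ((f 0 - x) / c)
  rw [div_lt_iff₀ hc] at hM hN
  obtain ⟨i, hi, hi'⟩ := Int.exists_greatest_of_bdd (P := fun i => f i ≤ x)
    ⟨M, fun i hi => hmono.le_iff_le.1 (hi.trans (by linarith [hup M]))⟩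
    ⟨-N, by linarith [hdown N]⟩
  exact ⟨i, hi, not_le.1 fun h => by linarith [hi' _ h]⟩

/-- Column `c` meets the lower curve of row `n` in the pair of vertices with indices `(c + 1) * n`
and `(c + 1) * n + 1`. Here we count the columns among the first `k` that start below row `n` and
lie to the left of the vertex with index `j`. -/
def leftPairs (k : ℕ) (n j : ℤ) : ℕ :=
  ((Finset.range k).filter fun c : ℕ => (c : ℤ) < n ∧ (c + 1) * n < j).card

/-- The number of columns among the first `k` that start below row `n` and
lie to the left of the wall with index `j` in row `n - 1`. -/
def leftColumns (k : ℕ) (n j : ℤ) : ℕ :=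
  ((Finset.range k).filter fun c : ℕ => (c : ℤ) < n ∧ (c + 1) * (n - 1) < j).card

/-- The tile `(n, i)` lies in a column that started below row `n`. -/
def InColumn (k : ℕ) (n i : ℤ) : Prop :=
  ∃ c : ℕ, c < k ∧ (c : ℤ) < n ∧ (c + 1) * n = i

/-- The tile `(n, i)` is the first tile of a column. -/
def StartsColumn (k : ℕ) (n i : ℤ) : Prop :=
  0 ≤ n ∧ n < k ∧ i = (n + 1) * n

lemma leftPairs_le (k : ℕ) (n j : ℤ) : leftPairs k n j ≤ k :=
  (Finset.card_filter_le _ _).trans_eq (Finset.card_range k)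

lemma leftColumns_le (k : ℕ) (n j : ℤ) : leftColumns k n j ≤ k :=
  (Finset.card_filter_le _ _).trans_eq (Finset.card_range k)

/-- Columns are numbered from left to right, so those to the left of a wall form an initial segment,
and comparing with their number tests membership. -/
lemma lt_leftColumns_iff (k : ℕ) (n j : ℤ) (c : ℕ) :
    c < leftColumns k n j ↔ c < k ∧ (c : ℤ) < n ∧ (c + 1) * (n - 1) < j := by
  have := Finset.filter_range_eq_range_card (k := k)
    (p := fun c : ℕ => (c : ℤ) < n ∧ (c + 1) * (n - 1) < j) (by
      rintro c d hcd ⟨h1, h2⟩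
      have h3 : (c : ℤ) ≤ d := by exact_mod_cast hcd
      exact ⟨by linarith, by nlinarith⟩)
  rw [leftColumns, ← Finset.mem_range, ← this, Finset.mem_filter, Finset.mem_range]

/-- Write `(c + 1) * n = (c + 1) * (n - 1) + (c + 1)`: the two summands compare with `j` and with
the number of columns on the left in the same sense. Thus passing from a row to the curve above it
preserves which columns lie to the left. -/
lemma lt_add_leftColumns_iff {k : ℕ} {n j : ℤ} {c : ℕ} (hc : c < k) (hn : (c : ℤ) < n) :
    (c + 1) * n < j + leftColumns k n j ↔ c < leftColumns k n j := by
  have h := lt_leftColumns_iff k n j c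
  constructor
  · intro h1
    by_contra h2
    have h3 : ¬ ((c : ℤ) + 1) * (n - 1) < j := fun h3 => h2 (h.2 ⟨hc, hn, h3⟩)
    have h4 : (leftColumns k n j : ℤ) ≤ c := by exact_mod_cast not_lt.1 h2
    linarith
  · intro h1
    have h2 := (h.1 h1).2.2
    have h4 : (c : ℤ) + 1 ≤ leftColumns k n j := by exact_mod_cast h1
    linarith

lemma leftPairs_add_leftColumns (k : ℕ) (n j : ℤ) :
    leftPairs k n (j + leftColumns k n j) = leftColumns k n j := by
  rw [leftPairs]
  conv_rhs => rw [leftColumns]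
  congr 1
  ext c
  simp only [Finset.mem_filter, Finset.mem_range, and_congr_right_iff]
  intro hc hn
  rw [lt_add_leftColumns_iff hc hn, lt_leftColumns_iff]
  tauto

/-- The lower vertex `j` separates this upper vertex from the next, so no flat edge starts here. -/
lemma not_inColumn_add_leftColumns (k : ℕ) (n j : ℤ) : ¬ InColumn k n (j + leftColumns k n j) := by
  rintro ⟨c, hc, hn, h⟩
  have h0 := lt_add_leftColumns_iff (j := j) hc hn
  have h1 : leftColumns k n j ≤ c := not_lt.1 fun h1 => absurd (h0.2 h1) (by linarith)
  have h2 : ¬ ((c : ℤ) + 1) * (n - 1) < j := fun h3 =>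
    absurd ((lt_leftColumns_iff k n j c).2 ⟨hc, hn, h3⟩) (not_lt.2 h1)
  have h4 : (leftColumns k n j : ℤ) ≤ c := by exact_mod_cast h1
  linarith

open Classical in
lemma leftPairs_succ (k : ℕ) (n j : ℤ) :
    leftPairs k n (j + 1) = leftPairs k n j + if InColumn k n j then 1 else 0 := by
  rw [leftPairs, leftPairs]
  split_ifs with h
  · obtain ⟨c, hc, hn, rfl⟩ := h
    rw [← Finset.card_insert_of_notMem (a := c) (by simp)]
    congr 1
    ext d
    simp only [Finset.mem_filter, Finset.mem_range, Finset.mem_insert, Int.lt_add_one_iff]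
    constructor
    · rintro ⟨h1, h2, h3⟩
      rcases h3.lt_or_eq with h3 | h3
      · exact Or.inr ⟨h1, h2, h3⟩
      · left
        have : (d : ℤ) + 1 = c + 1 := mul_right_cancel₀ (by omega) h3
        omega
    · rintro (rfl | ⟨h1, h2, h3⟩)
      · exact ⟨hc, hn, le_rfl⟩
      · exact ⟨h1, h2, h3.le⟩
  · rw [add_zero]
    congr 1
    ext d
    simp only [Finset.mem_filter, Finset.mem_range, Int.lt_add_one_iff, and_congr_right_iff]
    exact fun h1 h2 => ⟨fun h3 => h3.lt_of_ne fun h4 => h ⟨d, h1, h2, h4⟩, le_of_lt⟩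

lemma startsColumn_or_inColumn_iff (k : ℕ) (n i : ℤ) :
    StartsColumn k n i ∨ InColumn k n i ↔ ∃ c : ℕ, c < k ∧ (c : ℤ) < n + 1 ∧ (c + 1) * n = i := by
  constructor
  · rintro (⟨h1, h2, rfl⟩ | ⟨c, h1, h2, h3⟩)
    · lift n to ℕ using h1
      exact ⟨n, by exact_mod_cast h2, by omega, rfl⟩
    · exact ⟨c, h1, by omega, h3⟩
  · rintro ⟨c, h1, h2, h3⟩
    rcases (Int.lt_add_one_iff.1 h2).lt_or_eq with h | h
    · exact Or.inr ⟨c, h1, h, h3⟩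
    · exact Or.inl ⟨by omega, by omega, by rw [← h3, h]⟩

lemma not_startsColumn_of_inColumn {k : ℕ} {n i : ℤ} (h : InColumn k n i) :
    ¬ StartsColumn k n i := by
  rintro ⟨h1, h2, h3⟩
  obtain ⟨c, hc, hn, h⟩ := h
  have : (c : ℤ) + 1 = n + 1 := mul_right_cancel₀ (by omega) (h.trans h3)
  omega

open Classical in
lemma leftColumns_succ (k : ℕ) (n i : ℤ) :
    leftColumns k (n + 1) (i + 1) =
      leftColumns k (n + 1) i + if StartsColumn k n i ∨ InColumn k n i then 1 else 0 := by
  rw [leftColumns, leftColumns]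
  simp only [add_sub_cancel_right]
  split_ifs with h <;> rw [startsColumn_or_inColumn_iff] at h
  · obtain ⟨c, hc, hn, rfl⟩ := h
    rw [← Finset.card_insert_of_notMem (a := c) (by simp)]
    congr 1
    ext d
    simp only [Finset.mem_filter, Finset.mem_range, Finset.mem_insert, Int.lt_add_one_iff]
    constructor
    · rintro ⟨h1, h2, h3⟩
      rcases h3.lt_or_eq with h3 | h3
      · exact Or.inr ⟨h1, h2, h3⟩
      · left
        -- At `n = 0` the product `(c + 1) * n` does not determine `c`, but only column 0 is then
        -- present.
        rcases eq_or_ne n 0 with rfl | hn0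
        · omega
        have : (d : ℤ) + 1 = c + 1 := mul_right_cancel₀ hn0 h3
        omega
    · rintro (rfl | ⟨h1, h2, h3⟩)
      · exact ⟨hc, Int.lt_add_one_iff.1 hn, le_rfl⟩
      · exact ⟨h1, h2, h3.le⟩
  · rw [add_zero]
    congr 1
    ext d
    simp only [Finset.mem_filter, Finset.mem_range, Int.lt_add_one_iff, and_congr_right_iff]
    exact fun h1 h2 => ⟨fun h3 => h3.lt_of_ne fun h4 => h ⟨d, h1, Int.lt_add_one_iff.2 h2, h4⟩,
      le_of_lt⟩

/-! ### Positions of the vertices. -/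

/-- The index of the upper vertex preceding the lower vertex with index `j` on the curve `n`. -/
def upperIndex (k : ℕ) (n j : ℤ) : ℤ := j + leftColumns k n j

/-- Abscissas of the upper vertices. -/
noncomputable def upperX (k : ℕ) (n j : ℤ) : ℝ := j - leftPairs k n j / 2

open Classical in
/-- The horizontal distance from an upper vertex to the lower vertex following it. -/
noncomputable def gap (k : ℕ) (q : ℝ) (n j : ℤ) : ℝ :=
  if 1 ≤ n ∧ n ≤ k then (if n * (n - 1) < j then (1 - q) / 4 else (3 + q) / 4) else 1 / 2

/-- Abscissas of the lower vertices. -/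
noncomputable def lowerX (k : ℕ) (q : ℝ) (n j : ℤ) : ℝ :=
  upperX k n (upperIndex k n j) + gap k q n j

lemma gap_mem (k : ℕ) {q : ℝ} (hq : 0 < q) (hq' : q ≤ 1 / 30) (n j : ℤ) :
    gap k q n j ∈ Set.Icc (1 / 5) (4 / 5) := by
  unfold gap
  constructor <;> split_ifs <;> linarith

lemma lowerX_eq (k : ℕ) (q : ℝ) (n j : ℤ) :
    lowerX k q n j = j + leftColumns k n j / 2 + gap k q n j := by
  rw [lowerX, upperX, upperIndex, leftPairs_add_leftColumns]
  push_cast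
  ring

/-- The drop turns the spacing `3/2` of lower vertices around a flat edge into the width `1 - q/2`
that gives the heptagon area 1. The two values of `gap` are `1/2 ± (1 + q)/4`, centred so that both
stay well inside the unit interval. -/
lemma gap_succ_of_startsColumn {k : ℕ} {n i : ℤ} (q : ℝ) (h : StartsColumn k n i) :
    gap k q (n + 1) (i + 1) = gap k q (n + 1) i - (1 + q) / 2 := by
  obtain ⟨h1, h2, rfl⟩ := h
  simp only [gap, add_sub_cancel_right]
  rw [if_pos (by omega), if_pos (by omega), if_pos (by omega), if_neg (by omega)]
  ring

lemma gap_succ_of_not_startsColumn {k : ℕ} {n i : ℤ} (q : ℝ) (h : ¬ StartsColumn k n i) :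
    gap k q (n + 1) (i + 1) = gap k q (n + 1) i := by
  simp only [gap, add_sub_cancel_right]
  by_cases hn : 1 ≤ n + 1 ∧ n + 1 ≤ k
  · have hi : i ≠ (n + 1) * n := fun hi => h ⟨by omega, by omega, hi⟩
    have : (n + 1) * n < i + 1 ↔ (n + 1) * n < i := by omega
    simp only [this]
  · rw [if_neg hn, if_neg hn]

lemma upperX_succ_of_inColumn {k : ℕ} {n j : ℤ} (h : InColumn k n j) :
    upperX k n (j + 1) = upperX k n j + 1 / 2 := by
  rw [upperX, upperX, leftPairs_succ, if_pos h]; push_cast; ring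

lemma upperX_succ_of_not_inColumn {k : ℕ} {n j : ℤ} (h : ¬ InColumn k n j) :
    upperX k n (j + 1) = upperX k n j + 1 := by
  rw [upperX, upperX, leftPairs_succ, if_neg h]; push_cast; ring

lemma upperX_succ_ge (k : ℕ) (n j : ℤ) : upperX k n j + 1 / 2 ≤ upperX k n (j + 1) := by
  by_cases h : InColumn k n j
  · rw [upperX_succ_of_inColumn h]
  · rw [upperX_succ_of_not_inColumn h]; linarith

lemma upperX_succ_le (k : ℕ) (n j : ℤ) : upperX k n (j + 1) ≤ upperX k n j + 1 := by
  by_cases h : InColumn k n j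
  · rw [upperX_succ_of_inColumn h]; linarith
  · rw [upperX_succ_of_not_inColumn h]

lemma strictMono_upperX (k : ℕ) (n : ℤ) : StrictMono (upperX k n) :=
  strictMono_int_of_lt_succ fun j => by linarith [upperX_succ_ge k n j]

lemma upperX_upperIndex_succ (k : ℕ) (n j : ℤ) :
    upperX k n (upperIndex k n j + 1) = upperX k n (upperIndex k n j) + 1 :=
  upperX_succ_of_not_inColumn (not_inColumn_add_leftColumns k n j)

lemma upperIndex_succ_of_column {k : ℕ} {n i : ℤ} (h : StartsColumn k n i ∨ InColumn k n i) :
    upperIndex k (n + 1) (i + 1) = upperIndex k (n + 1) i + 2 := by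
  rw [upperIndex, upperIndex, leftColumns_succ, if_pos h]; push_cast; ring

lemma upperIndex_succ_of_not_column {k : ℕ} {n i : ℤ}
    (h : ¬ (StartsColumn k n i ∨ InColumn k n i)) :
    upperIndex k (n + 1) (i + 1) = upperIndex k (n + 1) i + 1 := by
  rw [upperIndex, upperIndex, leftColumns_succ, if_neg h]; push_cast; ring

lemma upperIndex_succ_ge (k : ℕ) (n j : ℤ) : upperIndex k n j + 1 ≤ upperIndex k n (j + 1) := by
  obtain ⟨n, rfl⟩ : ∃ m, n = m + 1 := ⟨n - 1, by ring⟩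
  by_cases h : StartsColumn k n j ∨ InColumn k n j
  · rw [upperIndex_succ_of_column h]; omega
  · rw [upperIndex_succ_of_not_column h]

lemma strictMono_upperIndex (k : ℕ) (n : ℤ) : StrictMono (upperIndex k n) :=
  strictMono_int_of_lt_succ fun j => by linarith [upperIndex_succ_ge k n j]

/-- A column continues upwards: exactly `c` columns lie to the left of column `c`, so the flat
ceiling starts at index `(c + 1) * n + c + 1 = (c + 1) * (n + 1)`. This explains the choice of index
`(c + 1) * n`. -/
lemma inColumn_upperIndex_add_one {k : ℕ} {n i : ℤ} (h : StartsColumn k n i ∨ InColumn k n i) :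
    InColumn k (n + 1) (upperIndex k (n + 1) i + 1) := by
  obtain ⟨c, hc, hn, rfl⟩ := (startsColumn_or_inColumn_iff k n i).1 h
  have h1 := lt_leftColumns_iff k (n + 1) ((c + 1) * n)
  have h2 : leftColumns k (n + 1) ((c + 1) * n) = c := by
    apply le_antisymm
    · by_contra hlt
      have := ((h1 c).1 (not_le.1 hlt)).2.2
      simp at this
    · by_contra hlt
      have hd := (h1 (leftColumns k (n + 1) ((c + 1) * n))).not.1 (lt_irrefl _)
      rw [add_sub_cancel_right] at hd
      refine hd ⟨by omega, by omega, ?_⟩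
      have h3 : (leftColumns k (n + 1) ((c + 1) * n) : ℤ) + 1 ≤ c := by omega
      nlinarith
  exact ⟨c, hc, hn, by rw [upperIndex, h2]; ring⟩

/-- A floor has a lower vertex exactly when it is not flat: `upperIndex` advances by 1, or by 2
across a flat edge, and the index it skips is the start of that edge. -/
lemma exists_upperIndex_eq_iff (k : ℕ) (n i : ℤ) :
    (∃ j, upperIndex k n j = i) ↔ ¬ InColumn k n i := by
  constructor
  · rintro ⟨j, rfl⟩
    exact not_inColumn_add_leftColumns k n j
  · intro h
    obtain ⟨j, h1, h2⟩ := exists_int_le_lt (f := fun j => (upperIndex k n j : ℝ)) one_pos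
      (fun j => by exact_mod_cast upperIndex_succ_ge k n j) i
    replace h1 : upperIndex k n j ≤ i := by exact_mod_cast h1
    replace h2 : i < upperIndex k n (j + 1) := by exact_mod_cast h2
    rcases h1.eq_or_lt with h1 | h1
    · exact ⟨j, h1⟩
    exfalso
    obtain ⟨n, rfl⟩ : ∃ m, n = m + 1 := ⟨n - 1, by ring⟩
    by_cases hc : StartsColumn k n j ∨ InColumn k n j
    · rw [upperIndex_succ_of_column hc] at h2
      obtain rfl : i = upperIndex k (n + 1) j + 1 := by omega
      exact h (inColumn_upperIndex_add_one hc)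
    · rw [upperIndex_succ_of_not_column hc] at h2
      omega

lemma lowerX_succ_of_startsColumn {k : ℕ} {n i : ℤ} (q : ℝ) (h : StartsColumn k n i) :
    lowerX k q (n + 1) (i + 1) = lowerX k q (n + 1) i + 1 - q / 2 := by
  rw [lowerX_eq, lowerX_eq, leftColumns_succ, if_pos (Or.inl h), gap_succ_of_startsColumn q h]
  push_cast; ring

lemma lowerX_succ_of_inColumn {k : ℕ} {n i : ℤ} (q : ℝ) (h : InColumn k n i) :
    lowerX k q (n + 1) (i + 1) = lowerX k q (n + 1) i + 3 / 2 := by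
  rw [lowerX_eq, lowerX_eq, leftColumns_succ, if_pos (Or.inr h),
    gap_succ_of_not_startsColumn q (not_startsColumn_of_inColumn h)]
  push_cast; ring

lemma lowerX_succ_of_not_column {k : ℕ} {n i : ℤ} (q : ℝ)
    (h : ¬ (StartsColumn k n i ∨ InColumn k n i)) :
    lowerX k q (n + 1) (i + 1) = lowerX k q (n + 1) i + 1 := by
  rw [lowerX_eq, lowerX_eq, leftColumns_succ, if_neg h,
    gap_succ_of_not_startsColumn q (fun h' => h (Or.inl h'))]
  push_cast; ring

/-- The lean of a wall is `gap` plus half the two counts of columns to its left, each at most `k`.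
This bound, uniform over all tiles, is where the finiteness of the number of columns enters. -/
lemma lowerX_sub_upperX_mem (k : ℕ) {q : ℝ} (hq : 0 < q) (hq' : q ≤ 1 / 30) (n i : ℤ) :
    lowerX k q (n + 1) i - upperX k n i ∈ Set.Icc 0 ((k : ℝ) + 4 / 5) := by
  have h1 := gap_mem k hq hq' (n + 1) i
  have h2 : (leftPairs k n i : ℝ) ≤ k := by exact_mod_cast leftPairs_le k n i
  have h3 : (leftColumns k (n + 1) i : ℝ) ≤ k := by exact_mod_cast leftColumns_le k (n + 1) i
  have h4 : (0 : ℝ) ≤ leftPairs k n i := by positivity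
  have h5 : (0 : ℝ) ≤ leftColumns k (n + 1) i := by positivity
  rw [lowerX_eq, upperX]
  constructor <;> linarith [h1.1, h1.2]

/-! ### Comparison of lines, and areas of the tiles. -/

lemma lineAt_add_le {y₀ y₁ x₀ x₁ x₀' x₁' c y : ℝ} (hy : y₀ < y₁) (h₀ : x₀ + c ≤ x₀')
    (h₁ : x₁ + c ≤ x₁') (h : y ∈ Set.Icc y₀ y₁) :
    lineAt y₀ y₁ x₀ x₁ y + c ≤ lineAt y₀ y₁ x₀' x₁' y := by
  have h' : 0 < y₁ - y₀ := sub_pos.2 hy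
  have ht0 : 0 ≤ (y - y₀) / (y₁ - y₀) := div_nonneg (sub_nonneg.2 h.1) h'.le
  have ht1 : (y - y₀) / (y₁ - y₀) ≤ 1 := by rw [div_le_one h']; linarith [h.2]
  unfold lineAt
  nlinarith [mul_nonneg (sub_nonneg.2 h₁) ht0, mul_nonneg (sub_nonneg.2 h₀) (sub_nonneg.2 ht1)]

lemma lineAt_mono {y₀ y₁ x₀ x₁ x₀' x₁' y : ℝ} (hy : y₀ < y₁) (h₀ : x₀ ≤ x₀')
    (h₁ : x₁ ≤ x₁') (h : y ∈ Set.Icc y₀ y₁) :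
    lineAt y₀ y₁ x₀ x₁ y ≤ lineAt y₀ y₁ x₀' x₁' y := by
  simpa using lineAt_add_le (c := 0) hy (by simpa using h₀) (by simpa using h₁) h

open MeasureTheory in
lemma volume_union_of_inter_subset {S T : Set Plane} (hT : MeasurableSet T) {y : ℝ}
    (h : S ∩ T ⊆ {z | z 1 = y}) : volume (S ∪ T) = volume S + volume T :=
  measure_union₀ hT.nullMeasurableSet (measure_mono_null h (volume_setOf_apply_one_eq y))

section Volume

variable {q y a b l r s₁ s₂ : ℝ} {P : ConvexPolygon}

open MeasureTheory

lemma volume_trapezoid_union (h : TileBounds q a b l r s₁ s₂) :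
    volume (trapezoid y (y + 1 - q) a b l r ∪ trapezoid (y + 1 - q) (y + 1) l r s₁ s₂) =
      ENNReal.ofReal ((1 - q) * ((b - a) + (r - l)) / 2 + q * ((r - l) + (s₂ - s₁)) / 2) := by
  obtain ⟨hq, hq', hsl, hab, hal, hbr, hls, hss, hsr⟩ := h
  rw [volume_union_of_inter_subset (isClosed_trapezoid _ _ _ _).measurableSet (y := y + 1 - q)
      (fun z hz => le_antisymm hz.1.2.1 hz.2.1),
    volume_trapezoid (by linarith) (by linarith) (by linarith),
    volume_trapezoid (by linarith) (by linarith) (by linarith), ← ENNReal.ofReal_add]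
  · congr 1; ring
  · exact div_nonneg (mul_nonneg (by linarith) (by linarith)) zero_le_two
  · exact div_nonneg (mul_nonneg (by linarith) (by linarith)) zero_le_two

lemma IsTile.volume_of_empty (h : TileBounds q a b l r s₁ s₂) (hP : IsTile q y a b l r s₁ s₂ ∅ P) :
    volume P.region =
      ENNReal.ofReal ((1 - q) * ((b - a) + (r - l)) / 2 + q * ((r - l) + (s₂ - s₁)) / 2) := by
  rw [hP.region_eq, Set.biUnion_empty, Set.union_empty, volume_trapezoid_union h]

lemma IsTile.volume_of_singleton {p : ℝ} (h : TileBounds q a b l r s₁ s₂)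
    (hP : IsTile q y a b l r s₁ s₂ {p} P) :
    volume P.region = ENNReal.ofReal ((1 - q) * ((b - a) + (r - l)) / 2 +
      q * ((r - l) + (s₂ - s₁)) / 2 + q * (b - a) / 2) := by
  have ⟨hq, hq', hsl, hab, hal, hbr, hls, hss, hsr⟩ := h
  rw [hP.region_eq, Set.biUnion_singleton, volume_union_of_inter_subset
      (isClosed_trapezoid _ _ _ _).measurableSet (y := y), volume_trapezoid_union h,
    volume_trapezoid (by linarith) le_rfl (by linarith), ← ENNReal.ofReal_add]
  · congr 1; ring
  · exact add_nonneg (div_nonneg (mul_nonneg (by linarith) (by linarith)) zero_le_two)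
      (div_nonneg (mul_nonneg (by linarith) (by linarith)) zero_le_two)
  · exact div_nonneg (mul_nonneg (by linarith) (by linarith)) zero_le_two
  · rintro z ⟨hz | hz, hz'⟩
    · exact le_antisymm hz'.2.1 hz.1
    · exact le_antisymm hz'.2.1 (by linarith [hz.1])

end Volume

/-! ### The tiles in their places. -/

/-- The tile in row `n` between the walls with indices `i` and `i + 1`. -/
def IsTileAt (k : ℕ) (q : ℝ) (n i : ℤ) (P : ConvexPolygon) : Prop :=
  IsTile q n (upperX k n i) (upperX k n (i + 1)) (lowerX k q (n + 1) i) (lowerX k q (n + 1) (i + 1))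
    (upperX k (n + 1) (upperIndex k (n + 1) i + 1))
    (upperX k (n + 1) (upperIndex k (n + 1) (i + 1)))
    {p | ∃ j, upperIndex k n j = i ∧ p = lowerX k q n j} P

/-- The abscissa at height `y` of the wall with index `i` in row `n`. -/
noncomputable def wallAt (k : ℕ) (q : ℝ) (n i : ℤ) (y : ℝ) : ℝ :=
  lineAt n (n + 1 - q) (upperX k n i) (lowerX k q (n + 1) i) y

/-- The abscissa at height `y` of the edge of the curve `n` that ends in the lower vertex `j`. -/
noncomputable def descentAt (k : ℕ) (q : ℝ) (n j : ℤ) (y : ℝ) : ℝ :=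
  lineAt (n - q) n (lowerX k q n j) (upperX k n (upperIndex k n j)) y

/-- The abscissa at height `y` of the edge of the curve `n` that starts in the lower vertex `j`. -/
noncomputable def ascentAt (k : ℕ) (q : ℝ) (n j : ℤ) (y : ℝ) : ℝ :=
  lineAt (n - q) n (lowerX k q n j) (upperX k n (upperIndex k n j + 1)) y

section

variable {k : ℕ} {q : ℝ}

/-- The extent `r - a` is at most a lean plus a floor width, hence below `k + 3`; the clearances
`1/5` come from `gap` lying in `[1/5, 4/5]`. -/
lemma tileBounds (hq : 0 < q) (hq' : q ≤ 1 / 30) (hk : q * (k + 3) ≤ 1 / 10) (n i : ℤ) :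
    TileBounds q (upperX k n i) (upperX k n (i + 1)) (lowerX k q (n + 1) i)
      (lowerX k q (n + 1) (i + 1)) (upperX k (n + 1) (upperIndex k (n + 1) i + 1))
      (upperX k (n + 1) (upperIndex k (n + 1) (i + 1))) := by
  have h1 := lowerX_sub_upperX_mem k hq hq' n i
  have h2 := lowerX_sub_upperX_mem k hq hq' n (i + 1)
  have h3 := upperX_succ_le k n i
  have h4 := upperX_succ_ge k n i
  have g1 := gap_mem k hq hq' (n + 1) i
  have g2 := gap_mem k hq hq' (n + 1) (i + 1)
  refine ⟨hq, hq', ?_, by linarith, by linarith [h1.1], by linarith [h2.1], ?_, ?_, ?_⟩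
  · exact (mul_le_mul_of_nonneg_left (by linarith [h2.2]) hq.le).trans hk
  · rw [upperX_upperIndex_succ, lowerX]; linarith [g1.2]
  · exact (strictMono_upperX k _).monotone (upperIndex_succ_ge k _ _)
  · rw [lowerX]; linarith [g2.1]

/-- Three cases: inside a column, start of a column, ordinary. In each, substituting the widths
makes the area formula equal to 1 identically in `q`. -/
lemma exists_isTileAt (hq : 0 < q) (hq' : q ≤ 1 / 30) (hk : q * (k + 3) ≤ 1 / 10) (n i : ℤ) :
    ∃ P : ConvexPolygon, (StartsColumn k n i → P.numEdges = 7) ∧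
      (¬ StartsColumn k n i → P.numEdges = 6) ∧ MeasureTheory.volume P.region = 1 ∧
      IsTileAt k q n i P := by
  have hb := tileBounds hq hq' hk n i
  unfold IsTileAt
  by_cases h : InColumn k n i
  · have hD : {p | ∃ j, upperIndex k n j = i ∧ p = lowerX k q n j} = ∅ := by
      rw [Set.eq_empty_iff_forall_notMem]
      rintro _ ⟨j, hj, -⟩
      exact (exists_upperIndex_eq_iff k n i).1 ⟨j, hj⟩ h
    have hs : upperX k (n + 1) (upperIndex k (n + 1) (i + 1)) =
        upperX k (n + 1) (upperIndex k (n + 1) i + 1) + 1 / 2 := by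
      rw [upperIndex_succ_of_column (Or.inr h),
        ← upperX_succ_of_inColumn (inColumn_upperIndex_add_one (Or.inr h)), add_assoc]
      rfl
    obtain ⟨P, h6, hP⟩ := exists_hexagon_flat (y := n) hb (by linarith)
    refine ⟨P, fun h' => absurd h' (not_startsColumn_of_inColumn h), fun _ => h6, ?_, hD ▸ hP⟩
    rw [hP.volume_of_empty hb, ← ENNReal.ofReal_one, hs, upperX_succ_of_inColumn h,
      lowerX_succ_of_inColumn q h]
    congr 1
    ring
  · obtain ⟨j, hj⟩ := (exists_upperIndex_eq_iff k n i).2 h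
    have hD : {p | ∃ j, upperIndex k n j = i ∧ p = lowerX k q n j} = {lowerX k q n j} := by
      ext p
      constructor
      · rintro ⟨j', hj', rfl⟩
        rw [(strictMono_upperIndex k n).injective (hj'.trans hj.symm)]
        rfl
      · rintro rfl
        exact ⟨j, hj, rfl⟩
    have hg := gap_mem k hq hq' n j
    have hap : upperX k n i + 1 / 5 ≤ lowerX k q n j := by
      rw [lowerX, hj]; linarith [hg.1]
    have hpb : lowerX k q n j + 1 / 5 ≤ upperX k n (i + 1) := by
      rw [upperX_succ_of_not_inColumn h, lowerX, hj]; linarith [hg.2]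
    by_cases h' : StartsColumn k n i
    · have hs : upperX k (n + 1) (upperIndex k (n + 1) (i + 1)) =
          upperX k (n + 1) (upperIndex k (n + 1) i + 1) + 1 / 2 := by
        rw [upperIndex_succ_of_column (Or.inl h'),
          ← upperX_succ_of_inColumn (inColumn_upperIndex_add_one (Or.inl h')), add_assoc]
        rfl
      obtain ⟨P, h7, hP⟩ := exists_heptagon (y := n) hb (by linarith) hap hpb
      refine ⟨P, fun _ => h7, fun h'' => absurd h' h'', ?_, hD ▸ hP⟩
      rw [hP.volume_of_singleton hb, ← ENNReal.ofReal_one, hs, upperX_succ_of_not_inColumn h,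
        lowerX_succ_of_startsColumn q h']
      congr 1
      ring
    · have hc : ¬ (StartsColumn k n i ∨ InColumn k n i) := by tauto
      have hs : upperX k (n + 1) (upperIndex k (n + 1) i + 1) =
          upperX k (n + 1) (upperIndex k (n + 1) (i + 1)) := by
        rw [upperIndex_succ_of_not_column hc]
      obtain ⟨P, h6, hP⟩ := exists_hexagon (y := n) hb hs hap hpb
      refine ⟨P, fun h'' => absurd h'' h', fun _ => h6, ?_, hD ▸ hP⟩
      rw [hP.volume_of_singleton hb, ← ENNReal.ofReal_one, hs, upperX_succ_of_not_inColumn h,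
        lowerX_succ_of_not_column q hc]
      congr 1
      ring

/-! ### Order of walls and zigzag edges; covering and disjointness. -/

lemma lowerX_succ_ge (hq : 0 < q) (hq' : q ≤ 1 / 30) (n j : ℤ) :
    lowerX k q n j + 1 / 2 ≤ lowerX k q n (j + 1) := by
  obtain ⟨n, rfl⟩ : ∃ m, n = m + 1 := ⟨n - 1, by ring⟩
  by_cases h : StartsColumn k n j
  · rw [lowerX_succ_of_startsColumn q h]; linarith
  by_cases h' : InColumn k n j
  · rw [lowerX_succ_of_inColumn q h']; linarith
  · rw [lowerX_succ_of_not_column q (by tauto)]; linarith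

lemma wallAt_succ_ge (hq : 0 < q) (hq' : q ≤ 1 / 30) (n i : ℤ) {y : ℝ}
    (hy : y ∈ Set.Icc (n : ℝ) (n + 1 - q)) :
    wallAt k q n i y + 1 / 2 ≤ wallAt k q n (i + 1) y :=
  lineAt_add_le (by linarith) (upperX_succ_ge k n i) (lowerX_succ_ge hq hq' _ _) hy

lemma descentAt_succ_ge (hq : 0 < q) (hq' : q ≤ 1 / 30) (n j : ℤ) {y : ℝ}
    (hy : y ∈ Set.Icc (n - q : ℝ) n) :
    descentAt k q n j y + 1 / 2 ≤ descentAt k q n (j + 1) y := by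
  refine lineAt_add_le (by linarith) (lowerX_succ_ge hq hq' _ _) ?_ hy
  exact (upperX_succ_ge k n _).trans
    ((strictMono_upperX k n).monotone (upperIndex_succ_ge k n j))

lemma descentAt_le_ascentAt (hq : 0 < q) (n j : ℤ) {y : ℝ} (hy : y ∈ Set.Icc (n - q : ℝ) n) :
    descentAt k q n j y ≤ ascentAt k q n j y :=
  lineAt_mono (by linarith) le_rfl ((strictMono_upperX k n).monotone (by omega)) hy

lemma ascentAt_le_descentAt (hq : 0 < q) (hq' : q ≤ 1 / 30) (n j : ℤ) {y : ℝ}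
    (hy : y ∈ Set.Icc (n - q : ℝ) n) :
    ascentAt k q n j y ≤ descentAt k q n (j + 1) y :=
  lineAt_mono (by linarith) (by linarith [lowerX_succ_ge (k := k) hq hq' n j])
    ((strictMono_upperX k n).monotone (upperIndex_succ_ge k n j)) hy

lemma monotone_wallAt (hq : 0 < q) (hq' : q ≤ 1 / 30) {n : ℤ} {y : ℝ}
    (hy : y ∈ Set.Icc (n : ℝ) (n + 1 - q)) : Monotone fun i => wallAt k q n i y :=
  monotone_int_of_le_succ fun i => by linarith [wallAt_succ_ge (k := k) hq hq' n i hy]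

lemma monotone_descentAt (hq : 0 < q) (hq' : q ≤ 1 / 30) {n : ℤ} {y : ℝ}
    (hy : y ∈ Set.Icc (n - q : ℝ) n) : Monotone fun i => descentAt k q n i y :=
  monotone_int_of_le_succ fun i => by linarith [descentAt_succ_ge (k := k) hq hq' n i hy]

lemma ascentAt_le_descentAt_of_lt (hq : 0 < q) (hq' : q ≤ 1 / 30) {n i j : ℤ} (hij : i < j) {y : ℝ}
    (hy : y ∈ Set.Icc (n - q : ℝ) n) : ascentAt k q n i y ≤ descentAt k q n j y :=
  (ascentAt_le_descentAt hq hq' n i hy).trans (monotone_descentAt hq hq' hy hij)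

lemma ascentAt_le_ascentAt (hq : 0 < q) (hq' : q ≤ 1 / 30) {n i j : ℤ} (hij : i ≤ j) {y : ℝ}
    (hy : y ∈ Set.Icc (n - q : ℝ) n) : ascentAt k q n i y ≤ ascentAt k q n j y := by
  rcases hij.eq_or_lt with rfl | h
  · exact le_rfl
  · exact (ascentAt_le_descentAt_of_lt hq hq' h hy).trans (descentAt_le_ascentAt hq n j hy)

lemma IsTileAt.mem_region_iff {n i : ℤ} {P : ConvexPolygon} (hq : 0 < q) (hq' : q ≤ 1 / 30)
    (hP : IsTileAt k q n i P) (z : Plane) :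
    z ∈ P.region ↔
      (z 1 ∈ Set.Icc (n : ℝ) (n + 1 - q) ∧
        z 0 ∈ Set.Icc (wallAt k q n i (z 1)) (wallAt k q n (i + 1) (z 1))) ∨
      (z 1 ∈ Set.Icc ((n + 1 : ℤ) - q : ℝ) (n + 1 : ℤ) ∧
        z 0 ∈ Set.Icc (ascentAt k q (n + 1) i (z 1)) (descentAt k q (n + 1) (i + 1) (z 1))) ∨
      ∃ j, upperIndex k n j = i ∧ z 1 ∈ Set.Icc (n - q : ℝ) n ∧
        z 0 ∈ Set.Icc (descentAt k q n j (z 1)) (ascentAt k q n j (z 1)) := by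
  rw [hP.region_eq, Set.mem_union, Set.mem_union, or_assoc, mem_trapezoid_iff (by linarith),
    mem_trapezoid_iff (by linarith)]
  refine or_congr Iff.rfl (or_congr ?_ ?_)
  · simp only [ascentAt, descentAt, Int.cast_add, Int.cast_one]
  · simp only [Set.mem_iUnion, Set.mem_ofPred_eq, exists_prop]
    constructor
    · rintro ⟨_, ⟨j, rfl, rfl⟩, h⟩
      rw [mem_trapezoid_iff (by linarith)] at h
      exact ⟨j, rfl, h⟩
    · rintro ⟨j, rfl, h⟩
      refine ⟨_, ⟨j, rfl, rfl⟩, ?_⟩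
      rw [mem_trapezoid_iff (by linarith)]
      exact h

lemma exists_mem_region (hq : 0 < q) (hq' : q ≤ 1 / 30) {T : ℤ → ℤ → ConvexPolygon}
    (hT : ∀ n i, IsTileAt k q n i (T n i)) (z : Plane) : ∃ n i, z ∈ (T n i).region := by
  have h1 := Int.floor_le (z 1)
  have h2 := Int.lt_floor_add_one (z 1)
  set n := ⌊z 1⌋
  by_cases h : z 1 ≤ n + 1 - q
  · obtain ⟨i, hi, hi'⟩ := exists_int_le_lt (f := fun i => wallAt k q n i (z 1)) one_half_pos
      (fun i => wallAt_succ_ge hq hq' n i ⟨h1, h⟩) (z 0)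
    exact ⟨n, i, ((hT n i).mem_region_iff hq hq' z).2 (Or.inl ⟨⟨h1, h⟩, hi, hi'.le⟩)⟩
  · have hy : z 1 ∈ Set.Icc ((n + 1 : ℤ) - q : ℝ) (n + 1 : ℤ) := by
      push_cast; exact ⟨(not_le.1 h).le, h2.le⟩
    obtain ⟨j, hj, hj'⟩ := exists_int_le_lt (f := fun j => descentAt k q (n + 1) j (z 1))
      one_half_pos (fun j => descentAt_succ_ge hq hq' (n + 1) j hy) (z 0)
    -- Between two successive descents the ascent decides: to its left lies the floor tip of a tile
    -- above the curve, to its right the ceiling of a tile below it.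
    by_cases hx : z 0 ≤ ascentAt k q (n + 1) j (z 1)
    · exact ⟨n + 1, _, ((hT _ _).mem_region_iff hq hq' z).2
        (Or.inr (Or.inr ⟨j, rfl, hy, hj, hx⟩))⟩
    · exact ⟨n, j, ((hT _ _).mem_region_iff hq hq' z).2
        (Or.inr (Or.inl ⟨hy, (not_le.1 hx).le, hj'.le⟩))⟩

lemma IsTileAt.wallAt_le_of_mem_region (hq : 0 < q) (hq' : q ≤ 1 / 30) {m n i : ℤ}
    {P : ConvexPolygon} (hP : IsTileAt k q n i P) {x y : ℝ} (hy : y ∈ Set.Ioo (m : ℝ) (m + 1 - q))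
    (h : pt x y ∈ P.region) :
    n = m ∧ wallAt k q n i y ≤ x ∧ x ≤ wallAt k q n (i + 1) y := by
  obtain ⟨hy1, hy2⟩ := hy
  rw [hP.mem_region_iff hq hq'] at h
  simp only [pt_zero, pt_one] at h
  rcases h with ⟨⟨h1, h2⟩, h⟩ | ⟨⟨h1, h2⟩, -⟩ | ⟨j, -, ⟨h1, h2⟩, -⟩
  · have e1 : n < m + 1 := by exact_mod_cast (by linarith : (n : ℝ) < m + 1)
    have e2 : m < n + 1 := by exact_mod_cast (by linarith : (m : ℝ) < n + 1)
    exact ⟨by omega, h⟩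
  · push_cast at h1 h2
    have e1 : n < m := by exact_mod_cast (by linarith : (n : ℝ) < m)
    have e2 : m < n + 1 := by exact_mod_cast (by linarith : (m : ℝ) < n + 1)
    omega
  · have e1 : n < m + 1 := by exact_mod_cast (by linarith : (n : ℝ) < m + 1)
    have e2 : m < n := by exact_mod_cast (by linarith : (m : ℝ) < n)
    omega

lemma IsTileAt.zigzag_le_of_mem_region (hq : 0 < q) (hq' : q ≤ 1 / 30) {m n i : ℤ}
    {P : ConvexPolygon} (hP : IsTileAt k q n i P) {x y : ℝ} (hy : y ∈ Set.Ioo (m - q : ℝ) m)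
    (h : pt x y ∈ P.region) :
    (n + 1 = m ∧ ascentAt k q m i y ≤ x ∧ x ≤ descentAt k q m (i + 1) y) ∨
      n = m ∧ ∃ j, upperIndex k m j = i ∧ descentAt k q m j y ≤ x ∧ x ≤ ascentAt k q m j y := by
  obtain ⟨hy1, hy2⟩ := hy
  rw [hP.mem_region_iff hq hq'] at h
  simp only [pt_zero, pt_one] at h
  rcases h with ⟨⟨h1, h2⟩, -⟩ | ⟨⟨h1, h2⟩, h⟩ | ⟨j, hj, ⟨h1, h2⟩, h⟩
  · have e1 : n < m := by exact_mod_cast (by linarith : (n : ℝ) < m)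
    have e2 : m < n + 1 := by exact_mod_cast (by linarith : (m : ℝ) < n + 1)
    omega
  · push_cast at h1 h2
    have e1 : n < m := by exact_mod_cast (by linarith : (n : ℝ) < m)
    have e2 : m < n + 2 := by exact_mod_cast (by linarith : (m : ℝ) < n + 2)
    obtain rfl : n + 1 = m := by omega
    exact Or.inl ⟨rfl, h⟩
  · have e1 : n < m + 1 := by exact_mod_cast (by linarith : (n : ℝ) < m + 1)
    have e2 : m < n + 1 := by exact_mod_cast (by linarith : (m : ℝ) < n + 1)
    obtain rfl : n = m := by omega
    exact Or.inr ⟨rfl, j, hj, h⟩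

/-- At a height other than `m` and `m - q`, the tiles cut a horizontal line into intervals bounded
by consecutive walls, or by alternating descents and ascents. Two distinct such intervals share at
most an endpoint. -/
lemma eq_of_mem_regions (hq : 0 < q) (hq' : q ≤ 1 / 30) {n i n' i' : ℤ} {P P' : ConvexPolygon}
    (hP : IsTileAt k q n i P) (hP' : IsTileAt k q n' i' P') {y x₁ x₂ : ℝ}
    (hy : ∀ m : ℤ, y ≠ m ∧ y ≠ m - q) (hx : x₁ < x₂)
    (h₁ : pt x₁ y ∈ P.region) (h₁' : pt x₁ y ∈ P'.region)
    (h₂ : pt x₂ y ∈ P.region) (h₂' : pt x₂ y ∈ P'.region) : n = n' ∧ i = i' := by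
  have hf1 := (Int.floor_le y).lt_of_ne' (hy _).1
  have hf2 := Int.lt_floor_add_one y
  set m := ⌊y⌋
  rcases lt_or_ge y (m + 1 - q) with h | h
  · have hb : y ∈ Set.Ioo (m : ℝ) (m + 1 - q) := ⟨hf1, h⟩
    obtain ⟨rfl, h₁, -⟩ := hP.wallAt_le_of_mem_region hq hq' hb h₁
    obtain ⟨rfl, h₁', -⟩ := hP'.wallAt_le_of_mem_region hq hq' hb h₁'
    obtain ⟨-, -, h₂⟩ := hP.wallAt_le_of_mem_region hq hq' hb h₂
    obtain ⟨-, -, h₂'⟩ := hP'.wallAt_le_of_mem_region hq hq' hb h₂'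
    have hm := monotone_wallAt (k := k) hq hq' (Set.Ioo_subset_Icc_self hb)
    refine ⟨rfl, ?_⟩
    by_contra hne
    rcases lt_or_gt_of_ne hne with hlt | hlt
    · have h3 := hm (Int.add_one_le_iff.2 hlt)
      exact absurd hx (not_lt.2 ((h₂.trans h3).trans h₁'))
    · have h3 := hm (Int.add_one_le_iff.2 hlt)
      exact absurd hx (not_lt.2 ((h₂'.trans h3).trans h₁))
  · have hb : y ∈ Set.Ioo ((m + 1 : ℤ) - q : ℝ) (m + 1 : ℤ) := by
      refine ⟨lt_of_le_of_ne (by push_cast; exact h) (hy _).2.symm, by push_cast; exact hf2⟩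
    have hb' := Set.Ioo_subset_Icc_self hb
    have h₁ := hP.zigzag_le_of_mem_region hq hq' hb h₁
    have h₁' := hP'.zigzag_le_of_mem_region hq hq' hb h₁'
    have h₂ := hP.zigzag_le_of_mem_region hq hq' hb h₂
    have h₂' := hP'.zigzag_le_of_mem_region hq hq' hb h₂'
    generalize m + 1 = m at *
    -- The mixed case: a tile below the curve and a tile above it cannot share a segment.
    have key : ∀ i j, ascentAt k q m i y ≤ x₁ → x₂ ≤ descentAt k q m (i + 1) y →
        descentAt k q m j y ≤ x₁ → x₂ ≤ ascentAt k q m j y → False := by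
      intro i j h3 h4 h5 h6
      rcases le_or_gt j i with hij | hij
      · linarith [ascentAt_le_ascentAt (k := k) hq hq' hij hb']
      · linarith [monotone_descentAt (k := k) hq hq' hb' (Int.add_one_le_iff.2 hij)]
    rcases h₁ with ⟨e1, h₁, -⟩ | ⟨rfl, j, rfl, h₁, -⟩
    · obtain ⟨-, -, h₂⟩ : n + 1 = m ∧ _ := h₂.resolve_right fun h => by omega
      rcases h₁' with ⟨e2, h₁', -⟩ | ⟨rfl, j', rfl, h₁', -⟩
      · obtain ⟨-, -, h₂'⟩ : n' + 1 = m ∧ _ := h₂'.resolve_right fun h => by omega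
        refine ⟨by omega, ?_⟩
        by_contra hne
        rcases lt_or_gt_of_ne hne with hlt | hlt
        · linarith [ascentAt_le_descentAt_of_lt (k := k) hq hq' hlt hb',
            monotone_descentAt (k := k) hq hq' hb' (Int.add_one_le_iff.2 hlt),
            descentAt_le_ascentAt (k := k) hq m i' hb']
        · linarith [ascentAt_le_descentAt_of_lt (k := k) hq hq' hlt hb',
            monotone_descentAt (k := k) hq hq' hb' (Int.add_one_le_iff.2 hlt),
            descentAt_le_ascentAt (k := k) hq m i hb']
      · obtain ⟨-, l, hl, -, g₂'⟩ := h₂'.resolve_left fun h => by omega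
        obtain rfl := (strictMono_upperIndex k n').injective hl
        exact (key _ _ h₁ h₂ h₁' g₂').elim
    · obtain ⟨-, l, hl, -, g₂⟩ := h₂.resolve_left fun h => by omega
      obtain rfl := (strictMono_upperIndex k n).injective hl
      rcases h₁' with ⟨e2, h₁', -⟩ | ⟨rfl, j', rfl, h₁', -⟩
      · obtain ⟨-, -, h₂'⟩ := h₂'.resolve_right fun h => by omega
        exact (key _ _ h₁' h₂' h₁ g₂).elim
      · obtain ⟨-, l', hl', -, g₂'⟩ := h₂'.resolve_left fun h => by omega
        obtain rfl := (strictMono_upperIndex k n').injective hl'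
        refine ⟨rfl, ?_⟩
        congr 1
        by_contra hne
        rcases lt_or_gt_of_ne hne with hlt | hlt
        · linarith [ascentAt_le_descentAt_of_lt (k := k) hq hq' hlt hb']
        · linarith [ascentAt_le_descentAt_of_lt (k := k) hq hq' hlt hb']

/-- The exceptional heights are countable, so an open overlap contains a horizontal segment at a
generic height. -/
lemma exists_mem_regions_of_not_disjoint {P P' : ConvexPolygon} (q : ℝ)
    (h : ¬ Disjoint (interior P.region) (interior P'.region)) :
    ∃ x₁ x₂ y : ℝ, (∀ m : ℤ, y ≠ m ∧ y ≠ m - q) ∧ x₁ < x₂ ∧ pt x₁ y ∈ P.region ∧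
      pt x₁ y ∈ P'.region ∧ pt x₂ y ∈ P.region ∧ pt x₂ y ∈ P'.region := by
  obtain ⟨z, hz, hz'⟩ := Set.not_disjoint_iff.1 h
  set O := interior P.region ∩ interior P'.region with hO
  have hOo : IsOpen O := isOpen_interior.inter isOpen_interior
  have hpt : Continuous fun p : ℝ × ℝ => pt p.1 p.2 := by
    refine (PiLp.continuous_toLp 2 _).comp (continuous_pi fun i => ?_)
    fin_cases i
    · exact continuous_fst
    · exact continuous_snd
  have hcount : (Set.range (fun m : ℤ => (m : ℝ)) ∪ Set.range fun m : ℤ => (m : ℝ) - q).Countable :=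
    (Set.countable_range _).union (Set.countable_range _)
  obtain ⟨y, hy, hyc⟩ := (hcount.dense_compl ℝ).exists_mem_open
    (hOo.preimage (hpt.comp (Continuous.prodMk_right (z 0))))
    ⟨z 1, show pt (z 0) (z 1) ∈ O by rw [pt_eta]; exact ⟨hz, hz'⟩⟩
  have hx : ∀ᶠ x in nhds (z 0), pt x y ∈ O :=
    (hOo.preimage (hpt.comp (Continuous.prodMk_left y))).mem_nhds hyc
  obtain ⟨ε, hε, hb⟩ := Metric.eventually_nhds_iff.1 hx
  have h2 := hb (y := z 0 + ε / 2)
    (by rw [Real.dist_eq, add_sub_cancel_left, abs_of_pos] <;> linarith)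
  refine ⟨z 0, z 0 + ε / 2, y, fun m => ⟨?_, ?_⟩, by linarith, interior_subset hyc.1,
    interior_subset hyc.2, interior_subset h2.1, interior_subset h2.2⟩
  · rintro rfl; exact hy (Or.inl ⟨m, rfl⟩)
  · rintro rfl; exact hy (Or.inr ⟨m, rfl⟩)

/-- `eq_of_mem_regions` applied to the polygon and itself, on the slice at height `n + 1/2`. It
ensures that the heptagons are counted without repetition. -/
lemma IsTileAt.index_eq (hq : 0 < q) (hq' : q ≤ 1 / 30) {n i n' i' : ℤ} {P : ConvexPolygon}
    (hP : IsTileAt k q n i P) (hP' : IsTileAt k q n' i' P) : n = n' ∧ i = i' := by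
  have hy : (n : ℝ) + 1 / 2 ∈ Set.Icc (n : ℝ) (n + 1 - q) := ⟨by linarith, by linarith⟩
  have hw := wallAt_succ_ge (k := k) hq hq' n i hy
  have hlt : wallAt k q n i (n + 1 / 2) < wallAt k q n (i + 1) (n + 1 / 2) := by linarith
  have h1 : pt (wallAt k q n i (n + 1 / 2)) (n + 1 / 2) ∈ P.region :=
    (hP.mem_region_iff hq hq' _).2 (Or.inl ⟨hy, le_rfl, hlt.le⟩)
  have h2 : pt (wallAt k q n (i + 1) (n + 1 / 2)) (n + 1 / 2) ∈ P.region :=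
    (hP.mem_region_iff hq hq' _).2 (Or.inl ⟨hy, hlt.le, le_rfl⟩)
  refine eq_of_mem_regions hq hq' hP hP' (fun m => ⟨fun h => ?_, fun h => ?_⟩) hlt h1 h1 h2 h2
  · have e1 : n < m := by exact_mod_cast (by linarith : (n : ℝ) < m)
    have e2 : m < n + 1 := by exact_mod_cast (by linarith : (m : ℝ) < n + 1)
    omega
  · have e1 : n < m := by exact_mod_cast (by linarith : (n : ℝ) < m)
    have e2 : m < n + 1 := by exact_mod_cast (by linarith : (m : ℝ) < n + 1)
    omega

/-! ### The tiling is edge-to-edge. -/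

lemma IsTileAt.vertex_eq {n i : ℤ} {P : ConvexPolygon} (hP : IsTileAt k q n i P) {v : Plane}
    (hv : v ∈ P.vertexSet) :
    ∃ m j : ℤ, v = pt (upperX k m j) m ∨ v = pt (lowerX k q m j) (m - q) := by
  rcases hP.vertex v hv with h | h | h | h | h | h | ⟨_, ⟨j, -, rfl⟩, h⟩
  · exact ⟨_, _, Or.inl h⟩
  · exact ⟨_, _, Or.inl h⟩
  · exact ⟨n + 1, i, Or.inr (by rw [h]; push_cast; rfl)⟩
  · exact ⟨n + 1, i + 1, Or.inr (by rw [h]; push_cast; rfl)⟩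
  · exact ⟨n + 1, _, Or.inl (by rw [h]; push_cast; rfl)⟩
  · exact ⟨n + 1, _, Or.inl (by rw [h]; push_cast; rfl)⟩
  · exact ⟨n, j, Or.inr h⟩

lemma not_mem_Ioo_of_int_cast {a b m : ℤ} (h : b ≤ a + 1) (h' : (m : ℝ) ∈ Set.Ioo (a : ℝ) b) :
    False := by
  have h1 : a < m := by exact_mod_cast h'.1
  have h2 : m < b := by exact_mod_cast h'.2
  omega

/-- Vertices occur only at heights `m` and `m - q`, which a non-horizontal open edge avoids. A
horizontal edge joins consecutive upper vertices, and these are strictly ordered, so none lies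
strictly between. -/
lemma IsTileAt.vertex_notMem_openEdge (hq : 0 < q) (hq' : q ≤ 1 / 30) {n i n' i' : ℤ}
    {P P' : ConvexPolygon} (hP : IsTileAt k q n i P) (hP' : IsTileAt k q n' i' P') {v : Plane}
    (hv : v ∈ P.vertexSet) (e : Fin P'.numEdges) : v ∉ P'.openEdge e := by
  intro he
  obtain ⟨m, j, hv⟩ := hP.vertex_eq hv
  have hcons : ∀ a b : ℤ, b ≤ a + 1 → upperX k m j ∈ Set.Ioo (upperX k m a) (upperX k m b) →
      False := by
    rintro a b hab ⟨h1, h2⟩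
    have h3 := (strictMono_upperX k m).lt_iff_lt.1 h1
    have h4 := (strictMono_upperX k m).lt_iff_lt.1 h2
    omega
  have h2 : upperIndex k (n' + 1) (i' + 1) ≤ upperIndex k (n' + 1) i' + 1 + 1 := by
    by_cases h : StartsColumn k n' i' ∨ InColumn k n' i'
    · rw [upperIndex_succ_of_column h]; omega
    · rw [upperIndex_succ_of_not_column h]; omega
  have hE := hP'.edge e v he
  rcases hv with rfl | rfl
  · simp only [pt_zero, pt_one] at hE
    rcases hE with h | h | h | ⟨h, hx⟩ | ⟨h, hx⟩
    · exact not_mem_Ioo_of_int_cast (a := n') (b := n' + 1) (m := m) le_rfl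
        ⟨h.1, by push_cast; linarith [h.2]⟩
    · exact not_mem_Ioo_of_int_cast (a := n') (b := n' + 1) (m := m) le_rfl
        ⟨by linarith [h.1], by push_cast; linarith [h.2]⟩
    · exact not_mem_Ioo_of_int_cast (a := n' - 1) (b := n') (m := m) (by omega)
        ⟨by push_cast; linarith [h.1], h.2⟩
    · obtain rfl : m = n' := by exact_mod_cast h
      exact hcons _ _ le_rfl hx
    · obtain rfl : m = n' + 1 := by exact_mod_cast h
      exact hcons _ _ h2 hx
  · simp only [pt_one] at hE
    rcases hE with h | h | h | ⟨h, -⟩ | ⟨h, -⟩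
    · exact not_mem_Ioo_of_int_cast (a := n') (b := n' + 1) (m := m) le_rfl
        ⟨by linarith [h.1], by push_cast; linarith [h.2]⟩
    · exact not_mem_Ioo_of_int_cast (a := n' + 1) (b := n' + 2) (m := m) (by omega)
        ⟨by push_cast; linarith [h.1], by push_cast; linarith [h.2]⟩
    · exact not_mem_Ioo_of_int_cast (a := n') (b := n' + 1) (m := m) le_rfl
        ⟨by linarith [h.1], by push_cast; linarith [h.2]⟩
    · exact not_mem_Ioo_of_int_cast (a := n') (b := n' + 1) (m := m) le_rfl
        ⟨by linarith, by push_cast; linarith⟩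
    · exact not_mem_Ioo_of_int_cast (a := n' + 1) (b := n' + 2) (m := m) (by omega)
        ⟨by push_cast; linarith, by push_cast; linarith⟩

end

/-! ### Assembly of the tiling. -/

theorem theorem4 (k : ℕ) (hk : 2 ≤ k) :
    ∃ F : Set ConvexPolygon,
      IsTiling F ∧ IsEdgeToEdge F ∧ IsUnitArea F ∧ HasBoundedPerimeter F ∧
        (∀ P ∈ F, 6 ≤ P.numEdges) ∧
        {P ∈ F | P.numEdges ≠ 6}.encard = (k : ℕ∞) := by
  obtain ⟨q, hq, hq', hqk⟩ : ∃ q : ℝ, 0 < q ∧ q ≤ 1 / 30 ∧ q * (k + 3) ≤ 1 / 10 := by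
    have h3 : (0 : ℝ) ≤ k := k.cast_nonneg
    refine ⟨1 / (10 * (k + 3)), by positivity, ?_, ?_⟩
    · exact one_div_le_one_div_of_le (by norm_num) (by linarith)
    · rw [div_mul_eq_mul_div, one_mul, div_le_iff₀ (by positivity)]
      linarith
  choose T h7 h6 hvol hT using exists_isTileAt (k := k) hq hq' hqk
  have hedges : ∀ n i, (T n i).numEdges ≠ 6 ↔ StartsColumn k n i := by
    intro n i
    by_cases h : StartsColumn k n i
    · simp [h7 n i h, h]
    · simp [h6 n i h, h]
  refine ⟨{P | ∃ n i, T n i = P}, ⟨?_, ?_⟩, ?_, ?_, ?_, ?_, ?_⟩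
  · refine Set.eq_univ_of_forall fun z => ?_
    obtain ⟨n, i, h⟩ := exists_mem_region hq hq' hT z
    exact Set.mem_biUnion ⟨n, i, rfl⟩ h
  · rintro _ ⟨n, i, rfl⟩ _ ⟨n', i', rfl⟩ hne
    by_contra h
    obtain ⟨x₁, x₂, y, hy, hx, h₁, h₁', h₂, h₂'⟩ := exists_mem_regions_of_not_disjoint q h
    obtain ⟨rfl, rfl⟩ := eq_of_mem_regions hq hq' (hT n i) (hT n' i') hy hx h₁ h₁' h₂ h₂'
    exact hne rfl
  · rintro v ⟨_, ⟨n, i, rfl⟩, _, ⟨n', i', rfl⟩, -, hv, e, he⟩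
    exact (hT n i).vertex_notMem_openEdge hq hq' (hT n' i') hv e he
  · rintro _ ⟨n, i, rfl⟩
    exact hvol n i
  · refine ⟨1 / 2, 7 * (k + 5), by norm_num, ?_⟩
    rintro _ ⟨n, i, rfl⟩
    refine ⟨(hT n i).perimeter_ge, (hT n i).perimeter_le.trans ?_⟩
    have h1 := lowerX_sub_upperX_mem k hq hq' n (i + 1)
    have h2 := upperX_succ_le k n i
    linarith [h1.2]
  · rintro _ ⟨n, i, rfl⟩
    by_cases h : StartsColumn k n i
    · rw [h7 n i h]; norm_num
    · rw [h6 n i h]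
  · have : {P ∈ {P | ∃ n i, T n i = P} | P.numEdges ≠ 6} =
        (fun c : ℕ => T c ((c + 1) * c)) '' (Finset.range k : Set ℕ) := by
      ext P
      constructor
      · rintro ⟨⟨n, i, rfl⟩, h⟩
        obtain ⟨h1, h2, rfl⟩ := (hedges n i).1 h
        lift n to ℕ using h1
        exact ⟨n, by simpa using h2, rfl⟩
      · rintro ⟨c, hc, rfl⟩
        exact ⟨⟨_, _, rfl⟩, (hedges _ _).2 ⟨by omega, by simpa using hc, rfl⟩⟩
    rw [this, Set.InjOn.encard_image, Set.encard_coe_eq_coe_finsetCard, Finset.card_range]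
    -- If two heptagons coincide, one polygon sits at both addresses, so the rows agree.
    intro c _ d _ h
    have hc : IsTileAt k q c ((c + 1) * c) (T d ((d + 1) * d)) := by
      rw [← show T c ((c + 1) * c) = T d ((d + 1) * d) from h]
      exact hT _ _
    exact_mod_cast (hc.index_eq hq hq' (hT d ((d + 1) * d))).1
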